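/- **Setting.** Let $N\ge 0$, $T>0$, let $U,V$ be nonempty compact subsets of finite-dimensional normed spaces, and let $\ell:\mathbb R^N\times[0,T]\times U\times V\to\mathbb R$ be continuous, bounded, and Lipschitz in $(x,t)$ uniformly in $(u,v)$. Let $\Pi_2$ be the set of Borel probability measures on $\mathbb R^N$ with finite second moment, with the Monge–Kantorovich distance $\mathbf d_1(m,m')=\inf_\gamma\int|x-y|\,d\gamma(x,y)$, where $\gamma$ runs over the Borel probability measures on $\mathbb R^{2N}$ with marginals $m$ and $m'$. For $t_0\in[0,T]$ let $\mathcal U(t_0)$ and $\mathcal V(t_0)$ be the sets of measurable maps $[t_0,T]\to U$ and $[t_0,T]\to V$, up to a.e. equality, with the $L^1$ distance and its Borel $\sigma$-algebra. * For a subdivision $\Delta: t_0<t_1<\dots<t_n=T$ (with $n=0$ if $t_0=T$), $\mathcal A_\Delta(t_0)$ is the set of Borel maps $\alpha:\mathcal V(t_0)\to\mathcal U(t_0)$ such that, for $0\le i\le n-1$, $v_1=v_2$ a.e. on $[t_0,t_i]$ implies $\alpha(v_1)=\alpha(v_2)$ a.e. on $[t_0,t_{i+1}]$; $\mathcal A(t_0)=\bigcup_\Delta\mathcal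 A_\Delta(t_0)$. * $\mathcal B(t_0)$ is the set of Borel maps $\beta:\mathcal U(t_0)\to\mathcal V(t_0)$ such that for all $t\in[t_0,T]$ and $u_1,u_2\in\mathcal U(t_0)$ there is $\delta>0$ such that $u_1=u_2$ a.e. on $[t_0,t]$ implies $\beta(u_1)=\beta(u_2)$ a.e. on $[t_0,t+\delta]\cap[t_0,T]$. For $(\alpha,\beta)\in\mathcal A(t_0)\times\mathcal B(t_0)$, $\Phi(\alpha,\beta)=(u,v)$ is the unique pair of controls with $\alpha(v)=u$ and $\beta(u)=v$. Endow $\mathcal A(t_0)$ and $\mathcal B(t_0)$ with the distances $\sup_v\|\alpha_1(v)-\alpha_2(v)\|_{L^1}$ and $\sup_u\|\beta_1(u)-\beta_2(u)\|_{L^1}$ and their Borel $\sigma$-algebras. Let $(\Omega_1,P_1)$ and $(\Omega_2,P_2)$ be atomless standard Borel probability spaces. Let $\tilde{\mathcal A}_X(t_0)$ be the set of measurable maps from $\mathbb R^N\times\Omega_1$ to $\mathcal A_\Delta(t_0)$ for some $\Delta$, and $\tilde{\mathcal B}(t_0)$ the set of measurable maps $\Omega_2\to\mathcal B(t_0)$.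 For $m\in\Pi_2$ put $$\mathcal J(t_0,\alpha,\beta,m)=\int\int_{t_0}^T\ell\bigl(x,s,\Phi(\alpha(x,\omega_1),\beta(\omega_2))(s)\bigr)\,ds\;d(m\otimes P_1\otimes P_2)(x,\omega_1,\omega_2),$$ $$\mathbf V^+(t_0,m)=\inf_{\alpha\in\tilde{\mathcal A}_X(t_0)}\sup_{\beta\in\tilde{\mathcal B}(t_0)}\mathcal J(t_0,\alpha,\beta,m),\qquad \mathbf V^-(t_0,m)=\sup_{\beta\in\tilde{\mathcal B}(t_0)}\inf_{\alpha\in\tilde{\mathcal A}_X(t_0)}\mathcal J(t_0,\alpha,\beta,m).$$ **Claim.** 1. There is a constant $C\ge 0$ such that for all $t,t'\in[0,T]$ and $m,m'\in\Pi_2$, $$|\mathbf V^{\pm}(t,m)-\mathbf V^{\pm}(t',m')|\le C\bigl(|t-t'|+\mathbf d_1(m,m')\bigr).$$ 2. For every $t\in[0,T]$ the maps $m\mapsto\mathbf V^+(t,m)$ and $m\mapsto\mathbf V^-(t,m)$ are convex on $\Pi_2$: $\mathbf V^\pm(t,\lambda m_1+(1-\lambda)m_2)\le\lambda\mathbf V^\pm(t,m_1)+(1-\lambda)\mathbf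 V^\pm(t,m_2)$ for $m_1,m_2\in\Pi_2$ and $\lambda\in[0,1]$. -/

import Mathlib

open MeasureTheory Set
open scoped ENNReal NNReal

noncomputable section

namespace IncompleteInfoGame

/-! ### Probability measures with finite second moment and the Monge-Kantorovich distance -/

/-- The space of parameters `x`: Euclidean `ℝ^N`. -/
abbrev Space (N : ℕ) : Type := EuclideanSpace ℝ (Fin N)

/-- `Π₂`: Borel probability measures on `ℝ^N` with finite second moment. -/
def Pi2 (N : ℕ) : Set (Measure (Space N)) :=
  {m | IsProbabilityMeasure m ∧ ∫⁻ x, ‖x‖ₑ ^ 2 ∂m < ∞}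

/-- Borel measures on `ℝ^N × ℝ^N` with first marginal `m` and second marginal `m'`. -/
def couplings {N : ℕ} (m m' : Measure (Space N)) : Set (Measure (Space N × Space N)) :=
  {γ | γ.map Prod.fst = m ∧ γ.map Prod.snd = m'}

/-- The Monge-Kantorovich distance `d₁`, with values in `[0, ∞]`. -/
def d1 {N : ℕ} (m m' : Measure (Space N)) : ℝ≥0∞ :=
  ⨅ γ ∈ couplings m m', ∫⁻ p, ‖p.1 - p.2‖ₑ ∂γ

/-- `d₁` is finite on `Π₂`, so that its real part loses nothing there. -/
theorem d1_ne_top {N : ℕ} {m m' : Measure (Space N)} (hm : m ∈ Pi2 N) (hm' : m' ∈ Pi2 N) :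
    d1 m m' ≠ ∞ := by
  obtain ⟨h1, h2⟩ := hm
  obtain ⟨h1', h2'⟩ := hm'
  have key : ∀ μ : Measure (Space N), IsProbabilityMeasure μ → ∫⁻ x, ‖x‖ₑ ^ 2 ∂μ < ∞ →
      ∫⁻ x, ‖x‖ₑ ∂μ < ∞ := by
    intro μ hμ h
    have hle : ∫⁻ x, ‖x‖ₑ ∂μ ≤ ∫⁻ x, (1 + ‖x‖ₑ ^ 2) ∂μ := by
      refine lintegral_mono fun x => ?_
      rcases le_total ‖x‖ₑ 1 with hx | hx
      · exact hx.trans le_self_add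
      · calc ‖x‖ₑ = ‖x‖ₑ * 1 := (mul_one _).symm
          _ ≤ ‖x‖ₑ * ‖x‖ₑ := by gcongr
          _ = ‖x‖ₑ ^ 2 := (sq _).symm
          _ ≤ 1 + ‖x‖ₑ ^ 2 := le_add_self
    refine hle.trans_lt ?_
    rw [lintegral_add_left measurable_const]
    simpa using h
  have hc : m.prod m' ∈ couplings m m' := by
    constructor
    · simp [Measure.map_fst_prod]
    · simp [Measure.map_snd_prod]
  refine ne_top_of_le_ne_top ?_ (iInf₂_le _ hc)
  have hle : ∫⁻ p, ‖p.1 - p.2‖ₑ ∂(m.prod m') ≤ ∫⁻ p, (‖p.1‖ₑ + ‖p.2‖ₑ) ∂(m.prod m') :=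
    lintegral_mono fun p => enorm_sub_le
  refine ne_top_of_le_ne_top ?_ hle
  rw [lintegral_add_left (by fun_prop)]
  have e1 : ∫⁻ p, ‖p.1‖ₑ ∂(m.prod m') = ∫⁻ x, ‖x‖ₑ ∂m := by
    conv_rhs => rw [← hc.1]
    rw [lintegral_map (by fun_prop) measurable_fst]
  have e2 : ∫⁻ p, ‖p.2‖ₑ ∂(m.prod m') = ∫⁻ x, ‖x‖ₑ ∂m' := by
    conv_rhs => rw [← hc.2]
    rw [lintegral_map (by fun_prop) measurable_snd]
  rw [e1, e2]
  exact ENNReal.add_ne_top.2 ⟨(key m h1 h2).ne, (key m' h1' h2').ne⟩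

/-! ### Controls -/

section Controls

variable {E F : Type*} [NormedAddCommGroup E] [NormedAddCommGroup F]

/-- Measurable controls `[a,b] → K`, up to equality almost everywhere. (For compact `K` every such
control is integrable.) -/
@[ext]
structure Control (K : Set E) (a b : ℝ) where
  toLp : Lp E 1 (volume.restrict (Icc a b))
  mem : ∀ᵐ s ∂(volume.restrict (Icc a b)), toLp s ∈ K

instance (K : Set E) (a b : ℝ) : CoeFun (Control K a b) (fun _ => ℝ → E) :=
  ⟨fun u => (u.toLp : ℝ → E)⟩

/-- Controls carry the `L¹` distance. -/
instance (K : Set E) (a b : ℝ) : MetricSpace (Control K a b) :=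
  MetricSpace.induced Control.toLp (fun _ _ h => Control.ext h) inferInstance

instance (K : Set E) (a b : ℝ) : MeasurableSpace (Control K a b) := borel _

instance (K : Set E) (a b : ℝ) : BorelSpace (Control K a b) := ⟨rfl⟩

theorem Control.dist_eq {K : Set E} {a b : ℝ} (u₁ u₂ : Control K a b) :
    dist u₁ u₂ = ∫ s in Icc a b, ‖u₁ s - u₂ s‖ := by
  have h := L1.dist_eq_integral_dist u₁.toLp u₂.toLp
  simp only [dist_eq_norm (E := E)] at h
  exact h

/-- The constant control. -/
def Control.const {K : Set E} (a b : ℝ) (c : E) (hc : c ∈ K) : Control K a b :=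
  ⟨(memLp_const c).toLp (fun _ => c), by
    filter_upwards [(memLp_const (μ := volume.restrict (Icc a b)) (p := 1) c).coeFn_toLp] with s hs
    rw [hs]; exact hc⟩

/-- `u₁ ≡ u₂` almost everywhere on `[a, t] ∩ [a, b]`. -/
def AgreeUpTo {K : Set E} {a b : ℝ} (t : ℝ) (u₁ u₂ : Control K a b) : Prop :=
  ∀ᵐ s ∂(volume.restrict (Icc a b)), s ≤ t → u₁ s = u₂ s

/-- A subdivision `a = t₀ < t₁ < ... < tₙ = b`. -/
structure Subdivision (a b : ℝ) where
  n : ℕ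
  pt : Fin (n + 1) → ℝ
  strictMono : StrictMono pt
  pt_zero : pt 0 = a
  pt_last : pt (Fin.last n) = b

/-- Nonanticipativity with delay with respect to the subdivision `Δ`: if `v₁ ≡ v₂` a.e. on
`[a, tᵢ]` with `0 ≤ i ≤ n - 1`, then `α(v₁) ≡ α(v₂)` on `[a, tᵢ₊₁]`. -/
def DelayedAlong {K : Set E} {L : Set F} {a b : ℝ} (Δ : Subdivision a b)
    (α : Control L a b → Control K a b) : Prop :=
  ∀ (i : Fin Δ.n) (v₁ v₂ : Control L a b),
    AgreeUpTo (Δ.pt i.castSucc) v₁ v₂ → AgreeUpTo (Δ.pt i.succ) (α v₁) (α v₂)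

/-- Nonanticipativity with a positive delay that may depend on the time and on the controls which
are being answered: for all `t ∈ [a, b]` and all `u₁, u₂` there is `δ > 0` such that `u₁ ≡ u₂` a.e.
on `[a, t]` implies `β(u₁) ≡ β(u₂)` on `[a, t + δ]` (intersected with `[a, b]`). In particular `β`
is nonanticipative. -/
def DelayedAdaptively {K : Set E} {L : Set F} {a b : ℝ}
    (β : Control K a b → Control L a b) : Prop :=
  ∀ t ∈ Icc a b, ∀ u₁ u₂ : Control K a b, ∃ δ > 0,
    AgreeUpTo t u₁ u₂ → AgreeUpTo (t + δ) (β u₁) (β u₂)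

theorem agreeUpTo_left {K : Set E} {a b : ℝ} (u₁ u₂ : Control K a b) : AgreeUpTo a u₁ u₂ := by
  have h : ∀ᵐ s ∂(volume.restrict (Icc a b)), s ≠ a :=
    ae_restrict_of_ae (Measure.ae_ne volume a)
  filter_upwards [h, ae_restrict_mem measurableSet_Icc] with s hs hmem hle
  exact absurd (le_antisymm hle hmem.1) hs

theorem eq_of_agreeUpTo_right {K : Set E} {a b : ℝ} {u₁ u₂ : Control K a b}
    (h : AgreeUpTo b u₁ u₂) : u₁ = u₂ := by
  apply Control.ext
  apply Lp.ext
  filter_upwards [h, ae_restrict_mem measurableSet_Icc] with s hs hmem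
  exact hs hmem.2

theorem AgreeUpTo.mono {K : Set E} {a b : ℝ} {u₁ u₂ : Control K a b} {t t' : ℝ} (htt' : t' ≤ t)
    (h : AgreeUpTo t u₁ u₂) : AgreeUpTo t' u₁ u₂ := by
  filter_upwards [h] with s hs hle
  exact hs (hle.trans htt')

theorem Subdivision.mem {a b : ℝ} (Δ : Subdivision a b) (i : Fin (Δ.n + 1)) :
    Δ.pt i ∈ Icc a b :=
  ⟨Δ.pt_zero.symm.le.trans (Δ.strictMono.monotone (Fin.zero_le i)),
    (Δ.strictMono.monotone (Fin.le_last i)).trans Δ.pt_last.le⟩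

/-- The response to the response gains one step of the subdivision. -/
theorem agreeUpTo_step {K : Set E} {L : Set F} {a b : ℝ} {Δ : Subdivision a b}
    {α : Control L a b → Control K a b} {β : Control K a b → Control L a b}
    (hα : DelayedAlong Δ α) (hβ : DelayedAdaptively β) (i : Fin Δ.n) {v w : Control L a b}
    (h : AgreeUpTo (Δ.pt i.castSucc) v w) : AgreeUpTo (Δ.pt i.succ) (β (α v)) (β (α w)) := by
  obtain ⟨δ, hδ, hagree⟩ := hβ _ (Δ.mem i.succ) (α v) (α w)
  exact (hagree (hα i v w h)).mono (by linarith)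

/-- A strategy with delay along a subdivision and a strategy with adaptive delay determine exactly
one pair of controls `(u, v)` with `α(v) = u` and `β(u) = v`. -/
theorem existsUnique_outcome {K : Set E} {L : Set F} {a b : ℝ} (hL : L.Nonempty)
    {α : Control L a b → Control K a b} {β : Control K a b → Control L a b}
    (hα : ∃ Δ : Subdivision a b, DelayedAlong Δ α) (hβ : DelayedAdaptively β) :
    ∃! p : Control K a b × Control L a b, α p.2 = p.1 ∧ β p.1 = p.2 := by
  obtain ⟨Δ, hΔ⟩ := hα
  obtain ⟨c, hc⟩ := hL
  set f : Control L a b → Control L a b := fun v => β (α v) with hf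
  set v₀ : Control L a b := Control.const a b c hc
  have hit : ∀ k (hk : k < Δ.n + 1), AgreeUpTo (Δ.pt ⟨k, hk⟩) (f^[k] v₀) (f^[k + 1] v₀) := by
    intro k
    induction k with
    | zero =>
      intro hk
      have : Δ.pt ⟨0, hk⟩ = a := Δ.pt_zero
      rw [this]; exact agreeUpTo_left _ _
    | succ k ih =>
      intro hk
      have h := agreeUpTo_step hΔ hβ ⟨k, by omega⟩ (ih (by omega))
      rw [Function.iterate_succ_apply' f (k + 1), Function.iterate_succ_apply' f k] at *
      exact h
  have hfix : f (f^[Δ.n] v₀) = f^[Δ.n] v₀ := by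
    have h := hit Δ.n (by omega)
    have hl : Δ.pt ⟨Δ.n, by omega⟩ = b := Δ.pt_last
    rw [hl] at h
    rw [← Function.iterate_succ_apply' f]
    exact (eq_of_agreeUpTo_right h).symm
  refine ⟨(α (f^[Δ.n] v₀), f^[Δ.n] v₀), ⟨rfl, hfix⟩, ?_⟩
  rintro ⟨u, v⟩ ⟨h1, h2⟩
  have hv : f v = v := by
    simp only at h1 h2
    simp only [hf, h1, h2]
  have huniq : ∀ k (hk : k < Δ.n + 1), AgreeUpTo (Δ.pt ⟨k, hk⟩) v (f^[Δ.n] v₀) := by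
    intro k
    induction k with
    | zero =>
      intro hk
      have : Δ.pt ⟨0, hk⟩ = a := Δ.pt_zero
      rw [this]; exact agreeUpTo_left _ _
    | succ k ih =>
      intro hk
      have h := agreeUpTo_step hΔ hβ ⟨k, by omega⟩ (ih (by omega))
      change AgreeUpTo _ (f v) (f (f^[Δ.n] v₀)) at h
      rw [hv, hfix] at h
      exact h
  have hveq : v = f^[Δ.n] v₀ := by
    have h := huniq Δ.n (by omega)
    have hl : Δ.pt ⟨Δ.n, by omega⟩ = b := Δ.pt_last
    rw [hl] at h
    exact eq_of_agreeUpTo_right h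
  simp only at h1
  rw [← h1, hveq]

end Controls

/-! ### The game -/

/-- The data of the game: a horizon `T > 0`, nonempty compact sets `U`, `V` of actions, and a
running payoff `ℓ : ℝ^N × [0,T] × U × V → ℝ` which is continuous, bounded, and Lipschitz in `(x,t)`
uniformly in `(u,v)`. Only the values of `ℓ` on `ℝ^N × [0,T] × U × V` matter. -/
structure Game (N : ℕ) (E F : Type*) [NormedAddCommGroup E] [NormedAddCommGroup F] where
  T : ℝ
  T_pos : 0 < T
  U : Set E
  U_compact : IsCompact U
  U_nonempty : U.Nonempty
  V : Set F
  V_compact : IsCompact V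
  V_nonempty : V.Nonempty
  ℓ : Space N → ℝ → E → F → ℝ
  ℓ_continuous : ContinuousOn (fun p : Space N × ℝ × E × F => ℓ p.1 p.2.1 p.2.2.1 p.2.2.2)
    (univ ×ˢ Icc 0 T ×ˢ U ×ˢ V)
  ℓ_bounded : ∃ M : ℝ, ∀ x, ∀ t ∈ Icc 0 T, ∀ u ∈ U, ∀ v ∈ V, |ℓ x t u v| ≤ M
  ℓ_lipschitz : ∃ L : ℝ, ∀ x x', ∀ t ∈ Icc 0 T, ∀ t' ∈ Icc 0 T, ∀ u ∈ U, ∀ v ∈ V,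
    |ℓ x t u v - ℓ x' t' u v| ≤ L * (‖x - x'‖ + |t - t'|)

namespace Game

variable {N : ℕ} {E F : Type*} [NormedAddCommGroup E] [NormedAddCommGroup F]

/-- `A(t₀)`: the (pure) strategies of Player I, Borel measurable maps from the controls of Player II
to those of Player I that are nonanticipative with delay along some subdivision of `[t₀, T]`. -/
@[ext]
structure StrategyI (G : Game N E F) (t₀ : ℝ) where
  toFun : Control G.V t₀ G.T → Control G.U t₀ G.T
  measurable : Measurable toFun
  delayed : ∃ Δ : Subdivision t₀ G.T, DelayedAlong Δ toFun

instance (G : Game N E F) (t₀ : ℝ) :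
    CoeFun (G.StrategyI t₀) (fun _ => Control G.V t₀ G.T → Control G.U t₀ G.T) :=
  ⟨StrategyI.toFun⟩

/-- `B(t₀)`: the (pure) strategies of Player II, Borel measurable maps from the controls of Player I
to those of Player II that are nonanticipative with adaptive delay. -/
@[ext]
structure StrategyII (G : Game N E F) (t₀ : ℝ) where
  toFun : Control G.U t₀ G.T → Control G.V t₀ G.T
  measurable : Measurable toFun
  delayed : DelayedAdaptively toFun

instance (G : Game N E F) (t₀ : ℝ) :
    CoeFun (G.StrategyII t₀) (fun _ => Control G.U t₀ G.T → Control G.V t₀ G.T) :=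
  ⟨StrategyII.toFun⟩

/-- `A(t₀)` carries the distance `sup_v d(α₁(v), α₂(v))`. -/
instance (G : Game N E F) (t₀ : ℝ) : EMetricSpace (G.StrategyI t₀) :=
  EMetricSpace.induced (fun α => UniformFun.ofFun α.toFun)
    (fun _ _ h => StrategyI.ext (UniformFun.ofFun.injective h)) inferInstance

/-- `B(t₀)` carries the distance `sup_u d(β₁(u), β₂(u))`. -/
instance (G : Game N E F) (t₀ : ℝ) : EMetricSpace (G.StrategyII t₀) :=
  EMetricSpace.induced (fun β => UniformFun.ofFun β.toFun)
    (fun _ _ h => StrategyII.ext (UniformFun.ofFun.injective h)) inferInstance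

theorem edist_strategyI (G : Game N E F) (t₀ : ℝ) (α₁ α₂ : G.StrategyI t₀) :
    edist α₁ α₂ = ⨆ v, edist (α₁ v) (α₂ v) := rfl

theorem edist_strategyII (G : Game N E F) (t₀ : ℝ) (β₁ β₂ : G.StrategyII t₀) :
    edist β₁ β₂ = ⨆ u, edist (β₁ u) (β₂ u) := rfl

/-- `Φ(α, β)`: the unique pair of controls `(u, v)` with `α(v) = u` and `β(u) = v`. -/
def outcome (G : Game N E F) {t₀ : ℝ} (α : G.StrategyI t₀) (β : G.StrategyII t₀) :
    Control G.U t₀ G.T × Control G.V t₀ G.T :=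
  (existsUnique_outcome G.V_nonempty α.delayed β.delayed).choose

theorem outcome_eq_iff (G : Game N E F) {t₀ : ℝ} (α : G.StrategyI t₀) (β : G.StrategyII t₀)
    (u : Control G.U t₀ G.T) (v : Control G.V t₀ G.T) :
    (u, v) = G.outcome α β ↔ α v = u ∧ β u = v := by
  have h := (existsUnique_outcome G.V_nonempty α.delayed β.delayed).choose_spec
  constructor
  · intro he
    have h1 := h.1
    change α (G.outcome α β).2 = (G.outcome α β).1 ∧
      β (G.outcome α β).1 = (G.outcome α β).2 at h1
    rw [← he] at h1
    exact h1
  · intro he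
    exact h.2 (u, v) he

/-- Strategies of Player I, who knows the parameter `x` and may randomize: measurable maps from
`ℝ^N × Ω₁` to the strategies with delay along one common subdivision. Measurability refers to the
Borel structure of the sup distance. That space is not separable, so measurability is expressed as
strong measurability, that is, Borel measurability with separable range; a Borel measurable map
from a standard Borel space to a metric space always has separable range. -/
structure RandomStrategyI (G : Game N E F) (Ω₁ : Type*) [MeasurableSpace Ω₁] (t₀ : ℝ) where
  toFun : Space N × Ω₁ → G.StrategyI t₀
  stronglyMeasurable : StronglyMeasurable toFun
  delayed : ∃ Δ : Subdivision t₀ G.T, ∀ p, DelayedAlong Δ (toFun p)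

instance (G : Game N E F) (Ω₁ : Type*) [MeasurableSpace Ω₁] (t₀ : ℝ) :
    CoeFun (G.RandomStrategyI Ω₁ t₀) (fun _ => Space N × Ω₁ → G.StrategyI t₀) :=
  ⟨RandomStrategyI.toFun⟩

/-- Strategies of Player II: random variables on `Ω₂` with values in `B(t₀)` (measurability as for
Player I). -/
structure RandomStrategyII (G : Game N E F) (Ω₂ : Type*) [MeasurableSpace Ω₂] (t₀ : ℝ) where
  toFun : Ω₂ → G.StrategyII t₀
  stronglyMeasurable : StronglyMeasurable toFun

instance (G : Game N E F) (Ω₂ : Type*) [MeasurableSpace Ω₂] (t₀ : ℝ) :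
    CoeFun (G.RandomStrategyII Ω₂ t₀) (fun _ => Ω₂ → G.StrategyII t₀) :=
  ⟨RandomStrategyII.toFun⟩

variable {Ω₁ Ω₂ : Type*} [MeasurableSpace Ω₁] [MeasurableSpace Ω₂]

/-- The running payoff `∫_{t₀}^T ℓ(x, s, u(s), v(s)) ds`. -/
def runningPayoff (G : Game N E F) {t₀ : ℝ} (x : Space N)
    (p : Control G.U t₀ G.T × Control G.V t₀ G.T) : ℝ :=
  ∫ s in Icc t₀ G.T, G.ℓ x s (p.1 s) (p.2 s)

/-- The expected payoff `J(t₀, α, β, m)`. -/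
def payoff (G : Game N E F) (P₁ : Measure Ω₁) (P₂ : Measure Ω₂) (t₀ : ℝ)
    (α : G.RandomStrategyI Ω₁ t₀) (β : G.RandomStrategyII Ω₂ t₀) (m : Measure (Space N)) : ℝ :=
  ∫ q, G.runningPayoff q.1 (G.outcome (α (q.1, q.2.1)) (β q.2.2)) ∂(m.prod (P₁.prod P₂))

/-- The upper value `V⁺(t₀, m) = inf_α sup_β J(t₀, α, β, m)`. -/
def upperValue (G : Game N E F) (P₁ : Measure Ω₁) (P₂ : Measure Ω₂) (t₀ : ℝ)
    (m : Measure (Space N)) : ℝ :=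
  ⨅ α : G.RandomStrategyI Ω₁ t₀, ⨆ β : G.RandomStrategyII Ω₂ t₀, G.payoff P₁ P₂ t₀ α β m

/-- The lower value `V⁻(t₀, m) = sup_β inf_α J(t₀, α, β, m)`. -/
def lowerValue (G : Game N E F) (P₁ : Measure Ω₁) (P₂ : Measure Ω₂) (t₀ : ℝ)
    (m : Measure (Space N)) : ℝ :=
  ⨆ β : G.RandomStrategyII Ω₂ t₀, ⨅ α : G.RandomStrategyI Ω₁ t₀, G.payoff P₁ P₂ t₀ α β m

end Game

end IncompleteInfoGame

end

/-!
The values are compared by converting strategies of one game into strategies of another. If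
Player I can turn each of his strategies in a game `g` into a strategy in a game `f`, Player II each
of his strategies in `f` into one in `g`, and the payoffs in `f` exceed the corresponding ones in
`g` by at most `ε`, then `inf sup` and `sup inf` of `f` exceed those of `g` by at most `ε`
(`minmax_le_add`). There are three conversions.

* *Change of the law.* Given a coupling of `m` and `m'`, Player I, who observes `x'` with law `m'`,
  draws `x` from its conditional law given `x'` and plays as if he had observed `x`. Since the
  running payoff is Lipschitz in the parameter, this costs at most a multiple of the transport cost,
  whatever Player II does (`Game.exists_payoff_le_add_of_coupling`).
* *Splitting.* For the law `p m₁ + q m₂`, Player I draws from its conditional law given `x` the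
  index of the law from which `x` came, and plays a strategy which is good for that law. The payoff
  is the average of the two payoffs (`Game.exists_payoff_eq_average`), whence convexity of both
  values (`minmax_le_average`). The two strategies have delay along a common refinement of their
  subdivisions (`exists_common_refinement`).
* *Change of the initial time.* For `t ≤ t'`, a strategy on `[t', T]` becomes one on `[t, T]` by
  playing a constant before `t'` and forgetting what the opponent did there; a strategy on `[t, T]`
  becomes one on `[t', T]` by pretending that the opponent played a constant before `t'`. The
  outcomes then correspond by restriction (`Game.outcome_extend_left`,
  `Game.outcome_extend_right`), and the payoffs differ only by what is collected on `[t, t']`.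

The first two conversions need an auxiliary draw from a conditional law in addition to the
randomization of the original strategy. Both are generated from the single atomless space of
Player I: it carries a uniform variable, every Markov kernel into a standard Borel space is the law
of a measurable function of a uniform variable, and so every law with first marginal `m` is realized
on `m ⊗ P₁` over its first coordinate (`exists_randomization`).

The payoffs are integrals of measurable functions because the outcome is obtained from an arbitrary
control by a number of mutual answers which does not depend on chance, the subdivision being common
to all realizations (`Game.outcome_snd_eq_iterate`), and because strongly measurable random
functions can be evaluated at random points (`measurable_eval`).
-/

namespace IncompleteInfoGame

open ProbabilityTheory Filter Topology

/-! ### Randomization -/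

theorem continuous_cdf (μ : Measure ℝ) [IsProbabilityMeasure μ] [NullSingletonClass μ] :
    Continuous (cdf μ) := by
  rw [continuous_iff_continuousAt]
  intro x
  rw [(monotone_cdf μ).continuousAt_iff_leftLim_eq_rightLim, StieltjesFunction.rightLim_eq]
  have h : (cdf μ).measure {x} = 0 := by rw [measure_cdf]; exact measure_singleton x
  rw [StieltjesFunction.measure_singleton, ENNReal.ofReal_eq_zero] at h
  exact le_antisymm ((monotone_cdf μ).leftLim_le le_rfl) (by linarith)

/-- A continuous distribution function, evaluated at a variable with this distribution, is uniformly
distributed. -/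
theorem measure_cdf_le (μ : Measure ℝ) [IsProbabilityMeasure μ] [NullSingletonClass μ] {c : ℝ}
    (h0 : 0 < c) (h1 : c < 1) : μ {x | cdf μ x ≤ c} = ENNReal.ofReal c := by
  set S : Set ℝ := {x | cdf μ x ≤ c}
  have hclosed : IsClosed S := isClosed_le (continuous_cdf μ) continuous_const
  obtain ⟨y, hy⟩ : ∃ y, cdf μ y = c :=
    mem_range_of_exists_le_of_exists_ge (continuous_cdf μ)
      (((tendsto_cdf_atBot μ).eventually_le_const h0).exists)
      (((tendsto_cdf_atTop μ).eventually_const_le h1).exists)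
  obtain ⟨w, hw⟩ := ((tendsto_cdf_atTop μ).eventually_const_lt h1).exists
  have hbdd : BddAbove S :=
    ⟨w, fun x hx => le_of_lt ((monotone_cdf μ).reflect_lt (lt_of_le_of_lt hx hw))⟩
  have hz : sSup S ∈ S := hclosed.csSup_mem ⟨y, hy.le⟩ hbdd
  have hS : S = Iic (sSup S) :=
    Subset.antisymm (fun x hx => le_csSup hbdd hx)
      (fun x hx => (monotone_cdf μ hx).trans hz)
  have hval : cdf μ (sSup S) = c :=
    le_antisymm hz (hy ▸ monotone_cdf μ (le_csSup hbdd (show y ∈ S from hy.le)))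
  rw [hS, ← ofReal_cdf, hval]

/-- An atomless standard Borel probability space carries a uniformly distributed random variable:
embed the space into the real line and apply the distribution function of the embedding. -/
theorem exists_measurable_map_eq_volume {Ω : Type*} [MeasurableSpace Ω] [StandardBorelSpace Ω]
    (P : Measure Ω) [IsProbabilityMeasure P] [NullSingletonClass P] :
    ∃ u : Ω → unitInterval, Measurable u ∧ P.map u = volume := by
  have hg := measurableEmbedding_embeddingReal Ω
  set μ : Measure ℝ := P.map (embeddingReal Ω) with hμ
  have : IsProbabilityMeasure μ := Measure.isProbabilityMeasure_map hg.measurable.aemeasurable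
  have : NullSingletonClass μ := ⟨fun x => by
    rw [hμ, hg.map_apply]
    exact (subsingleton_singleton.preimage hg.injective).measure_zero P⟩
  have hmeas : Measurable fun ω => (⟨cdf μ (embeddingReal Ω ω), cdf_nonneg μ _, cdf_le_one μ _⟩ :
      unitInterval) :=
    ((continuous_cdf μ).measurable.comp hg.measurable).subtype_mk
  refine ⟨_, hmeas, ?_⟩
  have : IsProbabilityMeasure (P.map fun ω => (⟨cdf μ (embeddingReal Ω ω), cdf_nonneg μ _,
      cdf_le_one μ _⟩ : unitInterval)) := Measure.isProbabilityMeasure_map hmeas.aemeasurable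
  refine Measure.ext_of_Iic _ _ fun c => ?_
  have key : ∀ c : unitInterval, (P.map fun ω => (⟨cdf μ (embeddingReal Ω ω), cdf_nonneg μ _,
      cdf_le_one μ _⟩ : unitInterval)) (Iic c) = μ {x | cdf μ x ≤ c} := by
    intro c
    rw [Measure.map_apply hmeas measurableSet_Iic, hμ, hg.map_apply]
    rfl
  rw [key, unitInterval.volume_Iic]
  rcases eq_or_lt_of_le c.2.1 with h0 | h0
  · rw [← h0, ENNReal.ofReal_zero]
    -- at level `0` the event need not be a half-line, so it is squeezed below the levels `ε`
    refine le_antisymm (ENNReal.le_of_forall_pos_le_add fun ε hε _ => ?_) zero_le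
    have hlt : (0 : ℝ) < min (ε : ℝ) (1 / 2) := by positivity
    have h := measure_cdf_le μ hlt (lt_of_le_of_lt (min_le_right _ _) (by norm_num))
    calc μ {x | cdf μ x ≤ 0} ≤ μ {x | cdf μ x ≤ min (ε : ℝ) (1 / 2)} :=
          measure_mono fun x hx => le_trans hx hlt.le
      _ ≤ ENNReal.ofReal ε := h ▸ ENNReal.ofReal_le_ofReal (min_le_left _ _)
      _ = 0 + ε := by simp
  rcases eq_or_lt_of_le c.2.2 with h1 | h1
  · rw [h1]
    have : {x | cdf μ x ≤ 1} = univ := eq_univ_of_forall fun x => cdf_le_one μ x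
    rw [this]; simp
  · exact measure_cdf_le μ h0 h1

/-- Randomization: every law `ρ` on `X × Y` with first marginal `m` is the law of `(x, ψ(x, ω))`
under `m ⊗ P`, for a suitable measurable `ψ`, provided that `P` is atomless. -/
theorem exists_randomization {X Y Ω : Type*} [MeasurableSpace X] [MeasurableSpace Y]
    [StandardBorelSpace Y] [Nonempty Y] [MeasurableSpace Ω] [StandardBorelSpace Ω]
    (P : Measure Ω) [IsProbabilityMeasure P] [NullSingletonClass P]
    (m : Measure X) (ρ : Measure (X × Y)) [IsFiniteMeasure ρ] (hρ : ρ.fst = m) :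
    ∃ ψ : X × Ω → Y, Measurable ψ ∧ (m.prod P).map (fun p => (p.1, ψ p)) = ρ := by
  obtain ⟨u, hu, hPu⟩ := exists_measurable_map_eq_volume P
  obtain ⟨f, hf, hfκ⟩ := Kernel.exists_measurable_map_eq_unitInterval ρ.condKernel
  have hψ : Measurable fun p : X × Ω => f p.1 (u p.2) :=
    hf.comp (measurable_fst.prodMk (hu.comp measurable_snd))
  refine ⟨fun p => f p.1 (u p.2), hψ, ?_⟩
  have : IsFiniteMeasure m := hρ ▸ inferInstance
  conv_rhs => rw [← ρ.disintegrate ρ.condKernel, hρ]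
  ext s hs
  rw [Measure.map_apply (measurable_fst.prodMk hψ) hs, Measure.compProd_apply hs,
    Measure.prod_apply ((measurable_fst.prodMk hψ) hs)]
  refine lintegral_congr fun x => ?_
  have hfx : Measurable (f x) := hf.comp (measurable_const.prodMk measurable_id)
  rw [← hfκ x, ← hPu, Measure.map_map hfx hu,
    Measure.map_apply (hfx.comp hu) (measurable_prodMk_left hs)]
  rfl

/-! ### Restricting and extending controls -/

section Controls

variable {E F : Type*} [NormedAddCommGroup E] [NormedAddCommGroup F]

theorem Control.isometry_toLp (K : Set E) (a b : ℝ) :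
    Isometry (Control.toLp : Control K a b → Lp E 1 (volume.restrict (Icc a b))) :=
  fun _ _ => rfl

instance (K : Set E) (a b : ℝ) [SecondCountableTopology E] :
    SecondCountableTopology (Control K a b) :=
  have : Fact ((1 : ℝ≥0∞) ≠ ∞) := ⟨ENNReal.one_ne_top⟩
  (Control.isometry_toLp K a b).isEmbedding.secondCountableTopology

theorem Control.exists_subseq_tendsto_ae {K : Set E} {a b : ℝ} {w : ℕ → Control K a b}
    {w₀ : Control K a b} (hw : Tendsto w atTop (𝓝 w₀)) :
    ∃ ns : ℕ → ℕ, StrictMono ns ∧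
      ∀ᵐ s ∂(volume.restrict (Icc a b)), Tendsto (fun k => w (ns k) s) atTop (𝓝 (w₀ s)) :=
  (tendstoInMeasure_of_tendsto_Lp
    (((Control.isometry_toLp K a b).continuous.tendsto w₀).comp hw)).exists_seq_tendsto_ae

/-- The restriction of a control on `[a, b]` to `[a', b]`, for `a ≤ a'`. -/
noncomputable def Control.restrict {K : Set E} {a a' b : ℝ} (h : a ≤ a') (u : Control K a b) :
    Control K a' b :=
  ⟨((Lp.memLp u.toLp).mono_measure (Measure.restrict_mono (Icc_subset_Icc_left h) le_rfl)).toLp _,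
    by
      filter_upwards [MemLp.coeFn_toLp ((Lp.memLp u.toLp).mono_measure
          (Measure.restrict_mono (Icc_subset_Icc_left h) le_rfl)),
        ae_restrict_of_ae_restrict_of_subset (Icc_subset_Icc_left h) u.mem] with s hs hu
      rw [hs]; exact hu⟩

theorem Control.restrict_ae {K : Set E} {a a' b : ℝ} (h : a ≤ a') (u : Control K a b) :
    ∀ᵐ s ∂(volume.restrict (Icc a' b)), u.restrict h s = u s :=
  MemLp.coeFn_toLp ((Lp.memLp u.toLp).mono_measure
    (Measure.restrict_mono (Icc_subset_Icc_left h) le_rfl))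

theorem Control.memLp_piecewise {K : Set E} {a' b : ℝ} (u : Control K a' b) (a : ℝ) (c : E) :
    MemLp ((Ici a').piecewise u (fun _ => c)) 1 (volume.restrict (Icc a b)) := by
  refine MemLp.piecewise measurableSet_Ici ?_ (memLp_const c)
  rw [Measure.restrict_restrict measurableSet_Ici]
  have hsub : Ici a' ∩ Icc a b ⊆ Icc a' b := fun s hs => ⟨hs.1, hs.2.2⟩
  exact (Lp.memLp u.toLp).mono_measure (Measure.restrict_mono hsub le_rfl)

/-- The control on `[a, b]` which is constant equal to `c` before time `a'`, and follows a given
control on `[a', b]` from `a'` on. -/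
noncomputable def Control.extend {K : Set E} {a' b : ℝ} (a : ℝ) (c : E) (hc : c ∈ K)
    (u : Control K a' b) : Control K a b :=
  have hmem := u.memLp_piecewise a c
  ⟨hmem.toLp _, by
    have h : ∀ᵐ s, s ∈ Icc a' b → u s ∈ K := (ae_restrict_iff' measurableSet_Icc).1 u.mem
    filter_upwards [hmem.coeFn_toLp, ae_restrict_of_ae h, ae_restrict_mem measurableSet_Icc]
      with s hs hu hmem
    rw [hs]
    by_cases hsa : s ∈ Ici a'
    · rw [piecewise_eq_of_mem _ _ _ hsa]; exact hu ⟨hsa, hmem.2⟩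
    · rw [piecewise_eq_of_notMem _ _ _ hsa]; exact hc⟩

theorem Control.extend_ae {K : Set E} {a' b : ℝ} (a : ℝ) (c : E) (hc : c ∈ K)
    (u : Control K a' b) :
    ∀ᵐ s ∂(volume.restrict (Icc a b)), u.extend a c hc s = if a' ≤ s then u s else c := by
  have hmem := u.memLp_piecewise a c
  filter_upwards [hmem.coeFn_toLp] with s hs
  refine hs.trans ?_
  by_cases hsa : a' ≤ s
  · rw [piecewise_eq_of_mem _ _ _ (show s ∈ Ici a' from hsa), if_pos hsa]
  · rw [piecewise_eq_of_notMem _ _ _ (show s ∉ Ici a' from hsa), if_neg hsa]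

theorem Control.edist_eq {K : Set E} {a b : ℝ} (u₁ u₂ : Control K a b) :
    edist u₁ u₂ = ∫⁻ s in Icc a b, ‖u₁ s - u₂ s‖ₑ := by
  have h : edist u₁ u₂ = edist u₁.toLp u₂.toLp := rfl
  rw [h, Lp.edist_def, eLpNorm_one_eq_lintegral_enorm]
  rfl

theorem Control.lipschitzWith_restrict {K : Set E} {a a' b : ℝ} (h : a ≤ a') :
    LipschitzWith 1 (Control.restrict h : Control K a b → Control K a' b) := by
  refine LipschitzWith.of_edist_le fun u v => ?_
  rw [Control.edist_eq, Control.edist_eq]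
  calc ∫⁻ s in Icc a' b, ‖u.restrict h s - v.restrict h s‖ₑ
      = ∫⁻ s in Icc a' b, ‖u s - v s‖ₑ := by
        refine lintegral_congr_ae ?_
        filter_upwards [u.restrict_ae h, v.restrict_ae h] with s h1 h2
        rw [h1, h2]
    _ ≤ _ := lintegral_mono_set (Icc_subset_Icc_left h)

theorem Control.lipschitzWith_extend {K : Set E} (a a' b : ℝ) (c : E) (hc : c ∈ K) :
    LipschitzWith 1 (Control.extend a c hc : Control K a' b → Control K a b) := by
  refine LipschitzWith.of_edist_le fun u v => ?_
  rw [Control.edist_eq, Control.edist_eq]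
  calc ∫⁻ s in Icc a b, ‖u.extend a c hc s - v.extend a c hc s‖ₑ
      = ∫⁻ s in Icc a b, (Icc a' b).indicator (fun s => ‖u s - v s‖ₑ) s := by
        refine lintegral_congr_ae ?_
        filter_upwards [u.extend_ae a c hc, v.extend_ae a c hc, ae_restrict_mem measurableSet_Icc]
          with s h1 h2 hs
        rw [h1, h2]
        by_cases hsa : a' ≤ s
        · rw [indicator_of_mem (show s ∈ Icc a' b from ⟨hsa, hs.2⟩)]; simp [hsa]
        · rw [indicator_of_notMem (fun h => hsa h.1)]; simp [hsa]
    _ ≤ ∫⁻ s, (Icc a' b).indicator (fun s => ‖u s - v s‖ₑ) s := setLIntegral_le_lintegral _ _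
    _ = _ := lintegral_indicator measurableSet_Icc _

theorem agreeUpTo_iff {K : Set E} {a b t : ℝ} {u₁ u₂ : Control K a b} :
    AgreeUpTo t u₁ u₂ ↔ ∀ᵐ s, s ∈ Icc a b → s ≤ t → u₁ s = u₂ s :=
  ae_restrict_iff' measurableSet_Icc

theorem AgreeUpTo.restrict {K : Set E} {a a' b t : ℝ} (h : a ≤ a') {u₁ u₂ : Control K a b}
    (hu : AgreeUpTo t u₁ u₂) : AgreeUpTo t (u₁.restrict h) (u₂.restrict h) := by
  filter_upwards [u₁.restrict_ae h, u₂.restrict_ae h,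
    ae_restrict_of_ae_restrict_of_subset (Icc_subset_Icc_left h) hu] with s h1 h2 h3 hs
  rw [h1, h2, h3 hs]

theorem AgreeUpTo.extend {K : Set E} {a' b t : ℝ} (a : ℝ) (c : E) (hc : c ∈ K)
    {u₁ u₂ : Control K a' b} (hu : AgreeUpTo t u₁ u₂) :
    AgreeUpTo t (u₁.extend a c hc) (u₂.extend a c hc) := by
  filter_upwards [u₁.extend_ae a c hc, u₂.extend_ae a c hc, ae_restrict_of_ae (agreeUpTo_iff.1 hu),
    ae_restrict_mem measurableSet_Icc] with s h1 h2 h3 hmem hs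
  rw [h1, h2]
  split_ifs with hsa
  · exact h3 ⟨hsa, hmem.2⟩ hs
  · rfl

/-- Two extensions by the same constant agree before the controls to be extended start. -/
theorem agreeUpTo_extend {K : Set E} {a' b t : ℝ} (a : ℝ) (c : E) (hc : c ∈ K) (ht : t ≤ a')
    (u₁ u₂ : Control K a' b) : AgreeUpTo t (u₁.extend a c hc) (u₂.extend a c hc) :=
  ((agreeUpTo_left u₁ u₂).extend a c hc).mono ht

theorem Control.restrict_extend {K : Set E} {a a' b : ℝ} (h : a ≤ a') (c : E) (hc : c ∈ K)
    (u : Control K a' b) : (u.extend a c hc).restrict h = u := by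
  refine Control.ext (Lp.ext ?_)
  filter_upwards [(u.extend a c hc).restrict_ae h,
    ae_restrict_of_ae_restrict_of_subset (Icc_subset_Icc_left h) (u.extend_ae a c hc),
    ae_restrict_mem measurableSet_Icc] with s h1 h2 hs
  rw [h1, h2, if_pos hs.1]

end Controls

/-! ### Delays along finite sets of times -/

section Delay

variable {E F : Type*} [NormedAddCommGroup E] [NormedAddCommGroup F]
  {K : Set E} {L : Set F} {a b : ℝ}

/-- Nonanticipativity with delay with respect to a set `S` of times: controls which agree up to a
time in `S` are answered by controls which agree up to the next time in `S`. In contrast with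
`DelayedAlong`, this does not depend on an enumeration and is visibly monotone in `S`. -/
def DelayedOn (S : Finset ℝ) (α : Control L a b → Control K a b) : Prop :=
  ∀ s ∈ S, ∀ s', s < s' → (∀ r ∈ S, s < r → s' ≤ r) →
    ∀ v₁ v₂, AgreeUpTo s v₁ v₂ → AgreeUpTo s' (α v₁) (α v₂)

theorem DelayedOn.mono {S S' : Finset ℝ} {α : Control L a b → Control K a b} (hα : DelayedOn S α)
    (hSS' : S ⊆ S') (haS : a ∈ S) (ha : ∀ s ∈ S', a ≤ s) : DelayedOn S' α := by
  intro s hs s' hss' hgap v₁ v₂ hv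
  -- the last time of `S` which is not after `s`
  have hne : (S.filter (· ≤ s)).Nonempty := ⟨a, by simp [haS, ha s hs]⟩
  have hr := Finset.max'_mem _ hne
  rw [Finset.mem_filter] at hr
  refine hα _ hr.1 s' (hr.2.trans_lt hss') (fun q hq hlt => ?_) v₁ v₂ (hv.mono hr.2)
  by_contra! hlt'
  rcases le_or_gt q s with hqs | hqs
  · exact absurd (Finset.le_max' _ q (by simp [hq, hqs])) (not_le.2 hlt)
  · exact absurd (hgap q (hSS' hq) hqs) (not_le.2 hlt')

/-- The set of points of a subdivision. -/
noncomputable def Subdivision.points (Δ : Subdivision a b) : Finset ℝ := Finset.univ.image Δ.pt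

theorem Subdivision.left_mem_points (Δ : Subdivision a b) : a ∈ Δ.points :=
  Finset.mem_image.2 ⟨0, Finset.mem_univ _, Δ.pt_zero⟩

theorem Subdivision.right_mem_points (Δ : Subdivision a b) : b ∈ Δ.points :=
  Finset.mem_image.2 ⟨_, Finset.mem_univ _, Δ.pt_last⟩

theorem Subdivision.mem_Icc_of_mem_points (Δ : Subdivision a b) {s : ℝ} (hs : s ∈ Δ.points) :
    s ∈ Icc a b := by
  obtain ⟨i, -, rfl⟩ := Finset.mem_image.1 hs
  exact Δ.mem i

theorem DelayedAlong.delayedOn {Δ : Subdivision a b} {α : Control L a b → Control K a b}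
    (hα : DelayedAlong Δ α) : DelayedOn Δ.points α := by
  intro s hs s' hss' hgap v₁ v₂ hv
  obtain ⟨i, -, rfl⟩ := Finset.mem_image.1 hs
  induction i using Fin.lastCases with
  | last =>
    rw [Δ.pt_last] at hv
    rw [eq_of_agreeUpTo_right hv]
    exact Eventually.of_forall fun _ _ => rfl
  | cast j =>
    exact (hα j v₁ v₂ hv).mono (hgap _ (Finset.mem_image.2 ⟨_, Finset.mem_univ _, rfl⟩)
      (Δ.strictMono j.castSucc_lt_succ))

/-- A finite set of times in `[a, b]` which contains the endpoints is the set of points of a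
subdivision. -/
theorem exists_subdivision {S : Finset ℝ} (ha : a ∈ S) (hb : b ∈ S) (hS : ∀ s ∈ S, s ∈ Icc a b) :
    ∃ Δ : Subdivision a b, Δ.points = S := by
  have hcard : S.card = (S.card - 1) + 1 := by
    have := Finset.card_pos.2 ⟨a, ha⟩; omega
  have hz : S.orderEmbOfFin hcard 0 = a := by
    rw [← Fin.mk_zero, Finset.orderEmbOfFin_zero hcard (by omega)]
    exact le_antisymm (Finset.min'_le _ _ ha) (hS _ (Finset.min'_mem _ _)).1
  have hl : S.orderEmbOfFin hcard (Fin.last _) = b := by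
    have : S.orderEmbOfFin hcard (Fin.last _) = S.max' ⟨a, ha⟩ :=
      Finset.orderEmbOfFin_last hcard (by omega)
    rw [this]
    exact le_antisymm (hS _ (Finset.max'_mem _ _)).2 (Finset.le_max' _ _ hb)
  refine ⟨⟨S.card - 1, S.orderEmbOfFin hcard, (S.orderEmbOfFin hcard).strictMono, hz, hl⟩, ?_⟩
  exact Finset.image_orderEmbOfFin_univ S hcard

theorem DelayedOn.delayedAlong {Δ : Subdivision a b} {α : Control L a b → Control K a b}
    (hα : DelayedOn Δ.points α) : DelayedAlong Δ α := by
  intro i v₁ v₂ hv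
  refine hα _ (Finset.mem_image.2 ⟨_, Finset.mem_univ _, rfl⟩) _
    (Δ.strictMono i.castSucc_lt_succ) (fun r hr hlt => ?_) v₁ v₂ hv
  obtain ⟨j, -, rfl⟩ := Finset.mem_image.1 hr
  exact Δ.strictMono.monotone (Fin.castSucc_lt_iff_succ_le.1 (Δ.strictMono.lt_iff_lt.1 hlt))

/-- Strategies with delay along `Δ₁` or along `Δ₂` have delay along a common refinement. -/
theorem exists_common_refinement (Δ₁ Δ₂ : Subdivision a b) :
    ∃ Δ : Subdivision a b, ∀ α : Control L a b → Control K a b,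
      DelayedAlong Δ₁ α ∨ DelayedAlong Δ₂ α → DelayedAlong Δ α := by
  have hS : ∀ s ∈ Δ₁.points ∪ Δ₂.points, s ∈ Icc a b := fun s hs =>
    (Finset.mem_union.1 hs).elim Δ₁.mem_Icc_of_mem_points Δ₂.mem_Icc_of_mem_points
  obtain ⟨Δ, hΔ⟩ := exists_subdivision
    (Finset.mem_union_left _ Δ₁.left_mem_points) (Finset.mem_union_left _ Δ₁.right_mem_points) hS
  refine ⟨Δ, fun α hα => DelayedOn.delayedAlong ?_⟩
  rw [hΔ]
  rcases hα with hα | hα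
  · exact hα.delayedOn.mono Finset.subset_union_left Δ₁.left_mem_points fun s hs => (hS s hs).1
  · exact hα.delayedOn.mono Finset.subset_union_right Δ₂.left_mem_points fun s hs => (hS s hs).1

theorem Subdivision.nonempty (h : a ≤ b) : Nonempty (Subdivision a b) :=
  (exists_subdivision (S := {a, b}) (by simp) (by simp) (by simp [h])).nonempty

/-- Playing `c` on `[a₀, a]` and then forgetting what the opponent did there keeps the delay, along
a subdivision which only depends on the old one. -/
theorem exists_delayedAlong_extend (Δ : Subdivision a b) {a₀ : ℝ} (h : a₀ ≤ a) {c : E}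
    (hc : c ∈ K) :
    ∃ Δ' : Subdivision a₀ b, ∀ α : Control L a b → Control K a b, DelayedAlong Δ α →
      DelayedAlong Δ' (fun v => (α (v.restrict h)).extend a₀ c hc) := by
  have hab : a ≤ b := (Δ.mem_Icc_of_mem_points Δ.left_mem_points).2
  obtain ⟨Δ', hΔ'⟩ := exists_subdivision (a := a₀) (b := b) (S := insert a₀ Δ.points)
    (by simp) (by simp [Δ.right_mem_points]) (by
      intro s hs
      rcases Finset.mem_insert.1 hs with rfl | hs
      · exact ⟨le_rfl, h.trans hab⟩
      · exact Icc_subset_Icc_left h (Δ.mem_Icc_of_mem_points hs))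
  refine ⟨Δ', fun α hα => DelayedOn.delayedAlong ?_⟩
  rw [hΔ']
  intro s hs s' hss' hgap v₁ v₂ hv
  by_cases hsS : s ∈ Δ.points
  · exact (hα.delayedOn s hsS s' hss' (fun r hr => hgap r (Finset.mem_insert_of_mem hr)) _ _
      (hv.restrict h)).extend a₀ c hc
  · obtain rfl : s = a₀ := (Finset.mem_insert.1 hs).resolve_right hsS
    have hlt : s < a := lt_of_le_of_ne h fun he => hsS (he ▸ Δ.left_mem_points)
    exact agreeUpTo_extend s c hc
      (hgap a (Finset.mem_insert_of_mem Δ.left_mem_points) hlt) _ _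

/-- Starting at time `a`, pretending that the opponent played `c` on `[a₀, a]`, keeps the delay,
along a subdivision which only depends on the old one. -/
theorem exists_delayedAlong_restrict {a₀ : ℝ} (Δ : Subdivision a₀ b) (h : a₀ ≤ a) (hab : a ≤ b)
    {c : F} (hc : c ∈ L) :
    ∃ Δ' : Subdivision a b, ∀ α : Control L a₀ b → Control K a₀ b, DelayedAlong Δ α →
      DelayedAlong Δ' (fun v => (α (v.extend a₀ c hc)).restrict h) := by
  classical
  obtain ⟨Δ', hΔ'⟩ := exists_subdivision (a := a) (b := b)
    (S := insert a (insert b (Δ.points.filter (a ≤ ·))))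
    (by simp) (by simp) (by
      intro s hs
      simp only [Finset.mem_insert, Finset.mem_filter] at hs
      rcases hs with rfl | rfl | hs
      · exact ⟨le_rfl, hab⟩
      · exact ⟨hab, le_rfl⟩
      · exact ⟨hs.2, (Δ.mem_Icc_of_mem_points hs.1).2⟩)
  refine ⟨Δ', fun α hα => DelayedOn.delayedAlong ?_⟩
  rw [hΔ']
  have hα' : DelayedOn (insert a Δ.points) α :=
    hα.delayedOn.mono (Finset.subset_insert _ _) Δ.left_mem_points (by
      intro s hs
      rcases Finset.mem_insert.1 hs with rfl | hs
      · exact h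
      · exact (Δ.mem_Icc_of_mem_points hs).1)
  intro s hs s' hss' hgap v₁ v₂ hv
  have has : a ≤ s := by
    simp only [Finset.mem_insert, Finset.mem_filter] at hs
    rcases hs with rfl | rfl | hs
    exacts [le_rfl, hab, hs.2]
  refine (hα' s ?_ s' hss' (fun r hr hlt => hgap r ?_ hlt) _ _ (hv.extend a₀ c hc)).restrict h
  · simp only [Finset.mem_insert, Finset.mem_filter] at hs ⊢
    rcases hs with hs | rfl | hs
    exacts [Or.inl hs, Or.inr Δ.right_mem_points, Or.inr hs.1]
  · simp only [Finset.mem_insert, Finset.mem_filter] at hr ⊢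
    rcases hr with hr | hr
    exacts [Or.inl hr, Or.inr (Or.inr ⟨hr, has.trans hlt.le⟩)]

theorem DelayedAdaptively.extend {a₀ : ℝ} (h : a₀ ≤ a) {c : F} (hc : c ∈ L)
    {β : Control K a b → Control L a b} (hβ : DelayedAdaptively β) :
    DelayedAdaptively (fun u : Control K a₀ b => (β (u.restrict h)).extend a₀ c hc) := by
  intro t ht u₁ u₂
  rcases lt_or_ge t a with hta | hta
  · exact ⟨a - t, by linarith, fun _ => agreeUpTo_extend a₀ c hc (by linarith) _ _⟩
  · obtain ⟨δ, hδ, hagree⟩ := hβ t ⟨hta, ht.2⟩ (u₁.restrict h) (u₂.restrict h)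
    exact ⟨δ, hδ, fun hu => (hagree (hu.restrict h)).extend a₀ c hc⟩

theorem DelayedAdaptively.restrict {a₀ : ℝ} (h : a₀ ≤ a) {c : E} (hc : c ∈ K)
    {β : Control K a₀ b → Control L a₀ b} (hβ : DelayedAdaptively β) :
    DelayedAdaptively (fun u : Control K a b => (β (u.extend a₀ c hc)).restrict h) := by
  intro t ht u₁ u₂
  obtain ⟨δ, hδ, hagree⟩ := hβ t ⟨h.trans ht.1, ht.2⟩ (u₁.extend a₀ c hc) (u₂.extend a₀ c hc)
  exact ⟨δ, hδ, fun hu => (hagree (hu.extend a₀ c hc)).restrict h⟩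

end Delay

/-! ### Evaluating random functions -/

/-- Strongly measurable random functions can be evaluated at random points: the claim is clear for
random functions with finitely many values, and passes to the limit. -/
theorem measurable_eval {Z X C D : Type*} [MeasurableSpace Z] [TopologicalSpace X]
    [MeasurableSpace C] [TopologicalSpace D] [TopologicalSpace.PseudoMetrizableSpace D]
    [MeasurableSpace D] [BorelSpace D] (ev : X → C → D) (hmeas : ∀ x, Measurable (ev x))
    (hcont : ∀ c, Continuous fun x => ev x c) {f : Z → X} (hf : StronglyMeasurable f) {w : Z → C}
    (hw : Measurable w) : Measurable fun z => ev (f z) (w z) := by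
  refine measurable_of_tendsto_metrizable (f := fun n z => ev (hf.approx n z) (w z)) (fun n => ?_)
    (tendsto_pi_nhds.2 fun z => ((hcont (w z)).tendsto _).comp (hf.tendsto_approx z))
  exact (hf.approx n).measurable_bind (fun x z => ev x (w z)) fun x => (hmeas x).comp hw

namespace Game

variable {N : ℕ} {E F : Type*} [NormedAddCommGroup E] [NormedAddCommGroup F]

/-! ### The running payoff -/

/-- The running payoff only depends on the values of `ℓ` at admissible actions, so that `ℓ` may be
replaced by a function which is continuous everywhere. -/
theorem exists_continuous_extension (G : Game N E F) :
    ∃ f : Space N × ℝ × E × F → ℝ, Continuous f ∧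
      ∀ x, ∀ s ∈ Icc 0 G.T, ∀ u ∈ G.U, ∀ v ∈ G.V, f (x, s, u, v) = G.ℓ x s u v := by
  have hclosed : IsClosed (univ ×ˢ Icc 0 G.T ×ˢ G.U ×ˢ G.V : Set (Space N × ℝ × E × F)) :=
    isClosed_univ.prod (isClosed_Icc.prod (G.U_compact.isClosed.prod G.V_compact.isClosed))
  obtain ⟨g, hg⟩ := ContinuousMap.exists_restrict_eq hclosed
    ⟨_, G.ℓ_continuous.domRestrict⟩
  refine ⟨g, g.continuous, fun x s hs u hu v hv => ?_⟩
  exact congrArg (fun f => f ⟨(x, s, u, v), ⟨mem_univ _, hs, hu, hv⟩⟩) hg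

theorem admissible_ae (G : Game N E F) {t : ℝ} (ht : 0 ≤ t)
    (p : Control G.U t G.T × Control G.V t G.T) :
    ∀ᵐ s ∂(volume.restrict (Icc t G.T)), s ∈ Icc 0 G.T ∧ p.1 s ∈ G.U ∧ p.2 s ∈ G.V := by
  filter_upwards [p.1.mem, p.2.mem, ae_restrict_mem measurableSet_Icc] with s hu hv hs
  exact ⟨⟨ht.trans hs.1, hs.2⟩, hu, hv⟩

/-- The payoff rate along a pair of controls is integrable. -/
theorem integrable_rate (G : Game N E F) {t : ℝ} (ht : 0 ≤ t) (x : Space N)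
    (p : Control G.U t G.T × Control G.V t G.T) :
    IntegrableOn (fun s => G.ℓ x s (p.1 s) (p.2 s)) (Icc t G.T) := by
  obtain ⟨f, hf, hfl⟩ := G.exists_continuous_extension
  obtain ⟨M, hM⟩ := G.ℓ_bounded
  refine Integrable.of_bound (C := M) ?_ ?_
  · refine AEStronglyMeasurable.congr (f := fun s => f (x, s, p.1 s, p.2 s)) ?_ ?_
    · exact hf.comp_aestronglyMeasurable (aestronglyMeasurable_const.prodMk
        (aestronglyMeasurable_id.prodMk
          ((Lp.aestronglyMeasurable p.1.toLp).prodMk (Lp.aestronglyMeasurable p.2.toLp))))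
    · filter_upwards [G.admissible_ae ht p] with s hs
      exact hfl x s hs.1 _ hs.2.1 _ hs.2.2
  · filter_upwards [G.admissible_ae ht p] with s hs
    exact hM x s hs.1 _ hs.2.1 _ hs.2.2

theorem continuous_runningPayoff (G : Game N E F) {t : ℝ} (ht : 0 ≤ t) :
    Continuous fun q : Space N × Control G.U t G.T × Control G.V t G.T =>
      G.runningPayoff q.1 q.2 := by
  obtain ⟨f, hf, hfl⟩ := G.exists_continuous_extension
  obtain ⟨M, hM⟩ := G.ℓ_bounded
  refine SeqContinuous.continuous fun q q₀ hq => tendsto_of_subseq_tendsto fun ns hns => ?_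
  have hq' := hq.comp hns
  obtain ⟨n₁, hn₁, hu⟩ := Control.exists_subseq_tendsto_ae
    ((continuous_fst.comp continuous_snd).tendsto q₀ |>.comp hq')
  obtain ⟨n₂, hn₂, hv⟩ := Control.exists_subseq_tendsto_ae
    ((continuous_snd.comp continuous_snd).tendsto q₀ |>.comp hq' |>.comp hn₁.tendsto_atTop)
  refine ⟨n₁ ∘ n₂, ?_⟩
  have hx : Tendsto (fun k => (q (ns (n₁ (n₂ k)))).1) atTop (𝓝 q₀.1) :=
    (continuous_fst.tendsto q₀).comp
      ((hq'.comp hn₁.tendsto_atTop).comp hn₂.tendsto_atTop)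
  refine tendsto_integral_of_dominated_convergence (fun _ => M)
    (fun k => (G.integrable_rate ht _ _).aestronglyMeasurable) (integrable_const M) (fun k => ?_) ?_
  · filter_upwards [G.admissible_ae ht (q (ns (n₁ (n₂ k)))).2] with s hs
    exact hM _ s hs.1 _ hs.2.1 _ hs.2.2
  · have hadm : ∀ᵐ s ∂(volume.restrict (Icc t G.T)), ∀ k, s ∈ Icc 0 G.T ∧
        (q (ns (n₁ (n₂ k)))).2.1 s ∈ G.U ∧ (q (ns (n₁ (n₂ k)))).2.2 s ∈ G.V :=
      ae_all_iff.2 fun k => G.admissible_ae ht _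
    filter_upwards [hadm, G.admissible_ae ht q₀.2, hu, hv] with s hs hs₀ hus hvs
    rw [← hfl _ s hs₀.1 _ hs₀.2.1 _ hs₀.2.2]
    refine ((hf.tendsto _).comp (hx.prodMk_nhds (tendsto_const_nhds.prodMk_nhds
      ((hus.comp hn₂.tendsto_atTop).prodMk_nhds hvs)))).congr fun k => ?_
    exact hfl _ s (hs k).1 _ (hs k).2.1 _ (hs k).2.2

theorem abs_runningPayoff_le (G : Game N E F) {M : ℝ}
    (hM : ∀ x, ∀ t ∈ Icc 0 G.T, ∀ u ∈ G.U, ∀ v ∈ G.V, |G.ℓ x t u v| ≤ M) {t : ℝ}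
    (ht : t ∈ Icc 0 G.T) (x : Space N) (p : Control G.U t G.T × Control G.V t G.T) :
    |G.runningPayoff x p| ≤ M * (G.T - t) := by
  have h := norm_setIntegral_le_of_norm_le_const_ae' (μ := volume) (s := Icc t G.T) (C := M)
    (f := fun s => G.ℓ x s (p.1 s) (p.2 s)) (by simp) ?_
  · simpa [Game.runningPayoff, measureReal_def, ENNReal.toReal_ofReal (sub_nonneg.2 ht.2)] using h
  · refine (ae_restrict_iff' measurableSet_Icc).1 ?_
    filter_upwards [G.admissible_ae ht.1 p] with s hs
    exact hM x s hs.1 _ hs.2.1 _ hs.2.2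

theorem abs_runningPayoff_sub_le (G : Game N E F) {L : ℝ}
    (hL : ∀ x x', ∀ t ∈ Icc 0 G.T, ∀ t' ∈ Icc 0 G.T, ∀ u ∈ G.U, ∀ v ∈ G.V,
      |G.ℓ x t u v - G.ℓ x' t' u v| ≤ L * (‖x - x'‖ + |t - t'|)) {t : ℝ}
    (ht : t ∈ Icc 0 G.T) (x x' : Space N) (p : Control G.U t G.T × Control G.V t G.T) :
    |G.runningPayoff x p - G.runningPayoff x' p| ≤ L * ‖x - x'‖ * (G.T - t) := by
  have h := norm_setIntegral_le_of_norm_le_const_ae' (μ := volume) (s := Icc t G.T)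
    (C := L * ‖x - x'‖)
    (f := fun s => G.ℓ x s (p.1 s) (p.2 s) - G.ℓ x' s (p.1 s) (p.2 s)) (by simp) ?_
  · rw [integral_sub (G.integrable_rate ht.1 x p) (G.integrable_rate ht.1 x' p)] at h
    simpa [Game.runningPayoff, measureReal_def, ENNReal.toReal_ofReal (sub_nonneg.2 ht.2)] using h
  · refine (ae_restrict_iff' measurableSet_Icc).1 ?_
    filter_upwards [G.admissible_ae ht.1 p] with s hs
    simpa using hL x x' s hs.1 s hs.1 _ hs.2.1 _ hs.2.2

/-- Dropping the payoff collected before `t'` changes the running payoff by at most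
`M * (t' - t)`. -/
theorem abs_runningPayoff_restrict_sub_le (G : Game N E F) {M : ℝ}
    (hM : ∀ x, ∀ t ∈ Icc 0 G.T, ∀ u ∈ G.U, ∀ v ∈ G.V, |G.ℓ x t u v| ≤ M) {t t' : ℝ}
    (ht : 0 ≤ t) (htt' : t ≤ t') (ht' : t' ≤ G.T) (x : Space N)
    (p : Control G.U t G.T × Control G.V t G.T) :
    |G.runningPayoff x p - G.runningPayoff x (p.1.restrict htt', p.2.restrict htt')|
      ≤ M * (t' - t) := by
  have hres : G.runningPayoff x (p.1.restrict htt', p.2.restrict htt')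
      = ∫ s in Icc t' G.T, G.ℓ x s (p.1 s) (p.2 s) := by
    refine integral_congr_ae ?_
    filter_upwards [p.1.restrict_ae htt', p.2.restrict_ae htt'] with s h1 h2
    rw [h1, h2]
  have hsplit : Icc t G.T = Ico t t' ∪ Icc t' G.T := (Ico_union_Icc_eq_Icc htt' ht').symm
  have hint := G.integrable_rate ht x p
  have hsub₁ : Ico t t' ⊆ Icc t G.T := hsplit ▸ subset_union_left
  have hsub₂ : Icc t' G.T ⊆ Icc t G.T := Icc_subset_Icc_left htt'
  have hrp : G.runningPayoff x p = (∫ s in Ico t t', G.ℓ x s (p.1 s) (p.2 s))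
      + ∫ s in Icc t' G.T, G.ℓ x s (p.1 s) (p.2 s) := by
    rw [← setIntegral_union _ measurableSet_Icc (hint.mono_set hsub₁) (hint.mono_set hsub₂),
      ← hsplit, Game.runningPayoff]
    exact Set.disjoint_left.2 fun s hs hs' => absurd hs.2 (not_lt.2 hs'.1)
  have h := norm_setIntegral_le_of_norm_le_const_ae' (μ := volume) (s := Ico t t') (C := M)
    (f := fun s => G.ℓ x s (p.1 s) (p.2 s)) (by simp) ?_
  · rw [hrp, hres, add_sub_cancel_right]
    simpa [measureReal_def, ENNReal.toReal_ofReal (sub_nonneg.2 htt')] using h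
  · have hadm := (ae_restrict_iff' measurableSet_Icc).1 (G.admissible_ae ht p)
    filter_upwards [hadm] with s hs hmem
    have h := hs ⟨hmem.1, hmem.2.le.trans ht'⟩
    exact hM x s h.1 _ h.2.1 _ h.2.2

/-! ### Measurability of the outcome -/

theorem continuous_eval_strategyI (G : Game N E F) {t : ℝ} (v : Control G.V t G.T) :
    Continuous fun α : G.StrategyI t => α v :=
  LipschitzWith.continuous (K := 1) <| LipschitzWith.of_edist_le fun α₁ α₂ => by
    rw [G.edist_strategyI]; exact le_iSup (fun v => edist (α₁ v) (α₂ v)) v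

theorem continuous_eval_strategyII (G : Game N E F) {t : ℝ} (u : Control G.U t G.T) :
    Continuous fun β : G.StrategyII t => β u :=
  LipschitzWith.continuous (K := 1) <| LipschitzWith.of_edist_le fun β₁ β₂ => by
    rw [G.edist_strategyII]; exact le_iSup (fun u => edist (β₁ u) (β₂ u)) u

theorem strategyI_outcome (G : Game N E F) {t : ℝ} (α : G.StrategyI t) (β : G.StrategyII t) :
    α (G.outcome α β).2 = (G.outcome α β).1 :=
  ((G.outcome_eq_iff α β _ _).1 rfl).1

theorem strategyII_outcome (G : Game N E F) {t : ℝ} (α : G.StrategyI t) (β : G.StrategyII t) :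
    β (G.outcome α β).1 = (G.outcome α β).2 :=
  ((G.outcome_eq_iff α β _ _).1 rfl).2

/-- The control of Player II in the outcome is reached from an arbitrary control after as many
rounds of mutual answers as the subdivision has intervals. -/
theorem outcome_snd_eq_iterate (G : Game N E F) {t : ℝ} (α : G.StrategyI t) (β : G.StrategyII t)
    {Δ : Subdivision t G.T} (hα : DelayedAlong Δ α.toFun) (v₀ : Control G.V t G.T) :
    (G.outcome α β).2 = (fun v => β (α v))^[Δ.n] v₀ := by
  have key : ∀ k (hk : k < Δ.n + 1),
      AgreeUpTo (Δ.pt ⟨k, hk⟩) (G.outcome α β).2 ((fun v => β (α v))^[k] v₀) := by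
    intro k
    induction k with
    | zero =>
      intro hk
      have : Δ.pt ⟨0, hk⟩ = t := Δ.pt_zero
      rw [this]; exact agreeUpTo_left _ _
    | succ k ih =>
      intro hk
      have h := agreeUpTo_step hα β.delayed ⟨k, by omega⟩ (ih (by omega))
      rw [G.strategyI_outcome, G.strategyII_outcome] at h
      rw [Function.iterate_succ_apply']
      exact h
  have h := key Δ.n (by omega)
  have hl : Δ.pt ⟨Δ.n, by omega⟩ = G.T := Δ.pt_last
  rw [hl] at h
  exact eq_of_agreeUpTo_right h

theorem measurable_outcome (G : Game N E F) {t : ℝ} {Z : Type*} [MeasurableSpace Z]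
    {A : Z → G.StrategyI t} (hA : StronglyMeasurable A)
    (hΔ : ∃ Δ : Subdivision t G.T, ∀ z, DelayedAlong Δ (A z).toFun)
    {B : Z → G.StrategyII t} (hB : StronglyMeasurable B) :
    Measurable fun z => G.outcome (A z) (B z) := by
  obtain ⟨Δ, hΔ⟩ := hΔ
  obtain ⟨c, hc⟩ := G.V_nonempty
  have hevA : ∀ {w : Z → Control G.V t G.T}, Measurable w → Measurable fun z => A z (w z) :=
    fun hw => measurable_eval (fun (α : G.StrategyI t) v => α v) (fun α => α.measurable)
      G.continuous_eval_strategyI hA hw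
  have hevB : ∀ {w : Z → Control G.U t G.T}, Measurable w → Measurable fun z => B z (w z) :=
    fun hw => measurable_eval (fun (β : G.StrategyII t) u => β u) (fun β => β.measurable)
      G.continuous_eval_strategyII hB hw
  have hit : ∀ k, Measurable fun z =>
      (fun v => B z (A z v))^[k] (Control.const t G.T c hc) := by
    intro k
    induction k with
    | zero => exact measurable_const
    | succ k ih =>
      simp only [Function.iterate_succ_apply']
      exact hevB (hevA ih)
  have h2 : Measurable fun z => (G.outcome (A z) (B z)).2 := by
    have : (fun z => (G.outcome (A z) (B z)).2) = fun z =>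
        (fun v => B z (A z v))^[Δ.n] (Control.const t G.T c hc) :=
      funext fun z => G.outcome_snd_eq_iterate _ _ (hΔ z) _
    rw [this]
    exact hit Δ.n
  have h1 : Measurable fun z => (G.outcome (A z) (B z)).1 := by
    simp only [← strategyI_outcome]
    exact hevA h2
  exact h1.prodMk h2

theorem measurable_runningPayoff_outcome [SecondCountableTopology E] [SecondCountableTopology F]
    (G : Game N E F) {t : ℝ} (ht : 0 ≤ t) {Z : Type*} [MeasurableSpace Z]
    {ξ : Z → Space N} (hξ : Measurable ξ) {A : Z → G.StrategyI t} (hA : StronglyMeasurable A)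
    (hΔ : ∃ Δ : Subdivision t G.T, ∀ z, DelayedAlong Δ (A z).toFun)
    {B : Z → G.StrategyII t} (hB : StronglyMeasurable B) :
    Measurable fun z => G.runningPayoff (ξ z) (G.outcome (A z) (B z)) :=
  (G.continuous_runningPayoff ht).measurable.comp (hξ.prodMk (G.measurable_outcome hA hΔ hB))

/-! ### The payoff against a random strategy of Player II -/

variable {Ω₁ Ω₂ : Type*} [MeasurableSpace Ω₁] [MeasurableSpace Ω₂]

/-- The expected payoff of a pure strategy of Player I against a random strategy of Player II, for a
given value `x` of the parameter. -/
noncomputable def purePayoff (G : Game N E F) (P₂ : Measure Ω₂) {t : ℝ}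
    (β : G.RandomStrategyII Ω₂ t) (x : Space N) (α : G.StrategyI t) : ℝ :=
  ∫ ω, G.runningPayoff x (G.outcome α (β ω)) ∂P₂

theorem measurable_purePayoff [SecondCountableTopology E] [SecondCountableTopology F]
    (G : Game N E F) (P₂ : Measure Ω₂) [IsProbabilityMeasure P₂] {t : ℝ} (ht : 0 ≤ t)
    (β : G.RandomStrategyII Ω₂ t) {Z : Type*} [MeasurableSpace Z]
    {ξ : Z → Space N} (hξ : Measurable ξ) {A : Z → G.StrategyI t} (hA : StronglyMeasurable A)
    (hΔ : ∃ Δ : Subdivision t G.T, ∀ z, DelayedAlong Δ (A z).toFun) :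
    Measurable fun z => G.purePayoff P₂ β (ξ z) (A z) := by
  obtain ⟨Δ, hΔ⟩ := hΔ
  have h : Measurable fun p : Z × Ω₂ => G.runningPayoff (ξ p.1) (G.outcome (A p.1) (β p.2)) :=
    G.measurable_runningPayoff_outcome ht (hξ.comp measurable_fst)
      (hA.comp_measurable measurable_fst) ⟨Δ, fun p => hΔ p.1⟩
      (β.stronglyMeasurable.comp_measurable measurable_snd)
  exact (h.stronglyMeasurable.integral_prod_right' (ν := P₂)).measurable

theorem abs_purePayoff_le (G : Game N E F) (P₂ : Measure Ω₂) [IsProbabilityMeasure P₂] {M : ℝ}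
    (hM : ∀ x, ∀ t ∈ Icc 0 G.T, ∀ u ∈ G.U, ∀ v ∈ G.V, |G.ℓ x t u v| ≤ M) {t : ℝ}
    (ht : t ∈ Icc 0 G.T) (β : G.RandomStrategyII Ω₂ t) (x : Space N) (α : G.StrategyI t) :
    |G.purePayoff P₂ β x α| ≤ M * (G.T - t) := by
  have h := norm_integral_le_of_norm_le_const (μ := P₂) (C := M * (G.T - t))
    (f := fun ω => G.runningPayoff x (G.outcome α (β ω)))
    (Eventually.of_forall fun ω => G.abs_runningPayoff_le hM ht x _)
  simpa [purePayoff] using h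

theorem integrable_purePayoff [SecondCountableTopology E] [SecondCountableTopology F]
    (G : Game N E F) (P₂ : Measure Ω₂) [IsProbabilityMeasure P₂] {t : ℝ} (ht : t ∈ Icc 0 G.T)
    (β : G.RandomStrategyII Ω₂ t) {Z : Type*} [MeasurableSpace Z] (μ : Measure Z)
    [IsFiniteMeasure μ] {ξ : Z → Space N} (hξ : Measurable ξ) {A : Z → G.StrategyI t}
    (hA : StronglyMeasurable A) (hΔ : ∃ Δ : Subdivision t G.T, ∀ z, DelayedAlong Δ (A z).toFun) :
    Integrable (fun z => G.purePayoff P₂ β (ξ z) (A z)) μ := by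
  obtain ⟨M, hM⟩ := G.ℓ_bounded
  exact Integrable.of_bound
    (G.measurable_purePayoff P₂ ht.1 β hξ hA hΔ).aestronglyMeasurable (M * (G.T - t))
    (Eventually.of_forall fun z => G.abs_purePayoff_le P₂ hM ht β _ _)

theorem integrable_runningPayoff_outcome [SecondCountableTopology E] [SecondCountableTopology F]
    (G : Game N E F) {t : ℝ} (ht : t ∈ Icc 0 G.T) {Z : Type*} [MeasurableSpace Z] (μ : Measure Z)
    [IsFiniteMeasure μ] {ξ : Z → Space N} (hξ : Measurable ξ) {A : Z → G.StrategyI t}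
    (hA : StronglyMeasurable A) (hΔ : ∃ Δ : Subdivision t G.T, ∀ z, DelayedAlong Δ (A z).toFun)
    {B : Z → G.StrategyII t} (hB : StronglyMeasurable B) :
    Integrable (fun z => G.runningPayoff (ξ z) (G.outcome (A z) (B z))) μ := by
  obtain ⟨M, hM⟩ := G.ℓ_bounded
  exact Integrable.of_bound
    (G.measurable_runningPayoff_outcome ht.1 hξ hA hΔ hB).aestronglyMeasurable (M * (G.T - t))
    (Eventually.of_forall fun z => G.abs_runningPayoff_le hM ht _ _)

theorem abs_purePayoff_sub_le [SecondCountableTopology E] [SecondCountableTopology F]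
    (G : Game N E F) (P₂ : Measure Ω₂) [IsProbabilityMeasure P₂] {L : ℝ}
    (hL : ∀ x x', ∀ t ∈ Icc 0 G.T, ∀ t' ∈ Icc 0 G.T, ∀ u ∈ G.U, ∀ v ∈ G.V,
      |G.ℓ x t u v - G.ℓ x' t' u v| ≤ L * (‖x - x'‖ + |t - t'|)) {t : ℝ}
    (ht : t ∈ Icc 0 G.T) (β : G.RandomStrategyII Ω₂ t) (x x' : Space N) (α : G.StrategyI t) :
    |G.purePayoff P₂ β x α - G.purePayoff P₂ β x' α| ≤ L * ‖x - x'‖ * (G.T - t) := by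
  have hint : ∀ x, Integrable (fun ω => G.runningPayoff x (G.outcome α (β ω))) P₂ := fun x =>
    G.integrable_runningPayoff_outcome ht P₂ measurable_const stronglyMeasurable_const
      (α.delayed.imp fun _ h _ => h) β.stronglyMeasurable
  rw [purePayoff, purePayoff, ← integral_sub (hint x) (hint x')]
  have h := norm_integral_le_of_norm_le_const (μ := P₂) (C := L * ‖x - x'‖ * (G.T - t))
    (f := fun ω => G.runningPayoff x (G.outcome α (β ω)) -
      G.runningPayoff x' (G.outcome α (β ω)))
    (Eventually.of_forall fun ω => G.abs_runningPayoff_sub_le hL ht x x' _)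
  simpa using h

theorem payoff_eq_integral_purePayoff [SecondCountableTopology E] [SecondCountableTopology F]
    (G : Game N E F) (P₁ : Measure Ω₁) [IsProbabilityMeasure P₁] (P₂ : Measure Ω₂)
    [IsProbabilityMeasure P₂] {t : ℝ} (ht : t ∈ Icc 0 G.T) (α : G.RandomStrategyI Ω₁ t)
    (β : G.RandomStrategyII Ω₂ t) (m : Measure (Space N)) [IsProbabilityMeasure m] :
    G.payoff P₁ P₂ t α β m = ∫ p, G.purePayoff P₂ β p.1 (α p) ∂(m.prod P₁) := by
  have hmp := measurePreserving_prodAssoc m P₁ P₂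
  obtain ⟨Δ, hΔ⟩ := α.delayed
  have hint : Integrable (fun q : (Space N × Ω₁) × Ω₂ =>
      G.runningPayoff q.1.1 (G.outcome (α q.1) (β q.2))) ((m.prod P₁).prod P₂) :=
    G.integrable_runningPayoff_outcome ht _ (measurable_fst.comp measurable_fst)
      (α.stronglyMeasurable.comp_measurable measurable_fst) ⟨Δ, fun q => hΔ q.1⟩
      (β.stronglyMeasurable.comp_measurable measurable_snd)
  rw [payoff, ← hmp.integral_comp MeasurableEquiv.prodAssoc.measurableEmbedding]
  exact integral_prod _ hint

end Game

/-! ### Comparison of values -/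

section MinMax

variable {A B A' B' : Type*} {f : A → B → ℝ} {g : A' → B' → ℝ} {R R' : ℝ}

theorem bddAbove_range_of_abs_le {ι : Type*} {f : ι → ℝ} (hf : ∀ i, |f i| ≤ R) :
    BddAbove (range f) :=
  ⟨R, by rintro _ ⟨i, rfl⟩; exact (abs_le.1 (hf i)).2⟩

theorem bddBelow_range_of_abs_le {ι : Type*} {f : ι → ℝ} (hf : ∀ i, |f i| ≤ R) :
    BddBelow (range f) :=
  ⟨-R, by rintro _ ⟨i, rfl⟩; exact (abs_le.1 (hf i)).1⟩

theorem abs_ciSup_le {ι : Type*} [Nonempty ι] {f : ι → ℝ} (hf : ∀ i, |f i| ≤ R) :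
    |⨆ i, f i| ≤ R :=
  abs_le.2 ⟨(abs_le.1 (hf (Classical.arbitrary ι))).1.trans
    (le_ciSup (bddAbove_range_of_abs_le hf) _), ciSup_le fun i => (abs_le.1 (hf i)).2⟩

theorem abs_ciInf_le {ι : Type*} [Nonempty ι] {f : ι → ℝ} (hf : ∀ i, |f i| ≤ R) :
    |⨅ i, f i| ≤ R :=
  abs_le.2 ⟨le_ciInf fun i => (abs_le.1 (hf i)).1,
    (ciInf_le (bddBelow_range_of_abs_le hf) _).trans (abs_le.1 (hf (Classical.arbitrary ι))).2⟩

/-- If the minimizer can transfer strategies from the game `g` to the game `f`, and the maximizer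
from `f` to `g`, at a cost of at most `ε`, then both values of `f` exceed those of `g` by at most
`ε`. -/
theorem minmax_le_add [Nonempty A] [Nonempty B] [Nonempty A'] [Nonempty B']
    (hf : ∀ a b, |f a b| ≤ R) (hg : ∀ a b, |g a b| ≤ R') {ε : ℝ} (φ : A' → A) (ψ : B → B')
    (h : ∀ a b, f (φ a) b ≤ g a (ψ b) + ε) :
    (⨅ a, ⨆ b, f a b) ≤ (⨅ a, ⨆ b, g a b) + ε ∧ (⨆ b, ⨅ a, f a b) ≤ (⨆ b, ⨅ a, g a b) + ε := by
  constructor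
  · rw [← sub_le_iff_le_add]
    refine le_ciInf fun a => ?_
    rw [sub_le_iff_le_add]
    refine (ciInf_le (bddBelow_range_of_abs_le fun a => abs_ciSup_le (hf a)) (φ a)).trans ?_
    refine ciSup_le fun b => (h a b).trans ?_
    gcongr
    exact le_ciSup (bddAbove_range_of_abs_le (hg a)) (ψ b)
  · refine ciSup_le fun b => ?_
    have h1 : (⨅ a, f a b) ≤ (⨅ a, g a (ψ b)) + ε := by
      rw [← sub_le_iff_le_add]
      refine le_ciInf fun a => ?_
      rw [sub_le_iff_le_add]
      exact (ciInf_le (bddBelow_range_of_abs_le fun a => hf a b) (φ a)).trans (h a b)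
    refine h1.trans ?_
    gcongr
    exact le_ciSup (bddAbove_range_of_abs_le fun b => abs_ciInf_le fun a => hg a b) (ψ b)

/-- If the minimizer can combine strategies in the games `g₁` and `g₂` into a strategy in `f` whose
payoff is the average of the payoffs, then both values of `f` are at most the averages of the
values of `g₁` and `g₂`. -/
theorem minmax_le_average [Nonempty A] [Nonempty B] {g₁ g₂ : A → B → ℝ}
    (hf : ∀ a b, |f a b| ≤ R) (hg₁ : ∀ a b, |g₁ a b| ≤ R) (hg₂ : ∀ a b, |g₂ a b| ≤ R) {p q : ℝ}
    (hp : 0 ≤ p) (hq : 0 ≤ q) (φ : A → A → A)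
    (h : ∀ a₁ a₂ b, f (φ a₁ a₂) b = p * g₁ a₁ b + q * g₂ a₂ b) :
    (⨅ a, ⨆ b, f a b) ≤ p * (⨅ a, ⨆ b, g₁ a b) + q * (⨅ a, ⨆ b, g₂ a b) ∧
      (⨆ b, ⨅ a, f a b) ≤ p * (⨆ b, ⨅ a, g₁ a b) + q * (⨆ b, ⨅ a, g₂ a b) := by
  constructor
  · rw [Real.mul_iInf_of_nonneg hp, Real.mul_iInf_of_nonneg hq]
    refine le_ciInf_add_ciInf fun a₁ a₂ => ?_
    refine (ciInf_le (bddBelow_range_of_abs_le fun a => abs_ciSup_le (hf a)) (φ a₁ a₂)).trans ?_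
    refine ciSup_le fun b => (h a₁ a₂ b).le.trans ?_
    gcongr
    · exact le_ciSup (bddAbove_range_of_abs_le (hg₁ a₁)) b
    · exact le_ciSup (bddAbove_range_of_abs_le (hg₂ a₂)) b
  · refine ciSup_le fun b => ?_
    have h1 : (⨅ a, f a b) ≤ p * (⨅ a, g₁ a b) + q * (⨅ a, g₂ a b) := by
      rw [Real.mul_iInf_of_nonneg hp, Real.mul_iInf_of_nonneg hq]
      exact le_ciInf_add_ciInf fun a₁ a₂ =>
        (ciInf_le (bddBelow_range_of_abs_le fun a => hf a b) (φ a₁ a₂)).trans (h a₁ a₂ b).le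
    refine h1.trans ?_
    gcongr
    · exact le_ciSup (bddAbove_range_of_abs_le fun b => abs_ciInf_le fun a => hg₁ a b) b
    · exact le_ciSup (bddAbove_range_of_abs_le fun b => abs_ciInf_le fun a => hg₂ a b) b

end MinMax

namespace Game

variable {N : ℕ} {E F : Type*} [NormedAddCommGroup E] [NormedAddCommGroup F]
  {Ω₁ Ω₂ : Type*} [MeasurableSpace Ω₁] [MeasurableSpace Ω₂]

theorem nonempty_randomStrategyI (G : Game N E F) {t : ℝ} (ht : t ≤ G.T) :
    Nonempty (G.RandomStrategyI Ω₁ t) := by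
  obtain ⟨c, hc⟩ := G.U_nonempty
  obtain ⟨Δ⟩ := Subdivision.nonempty ht
  have h : DelayedAlong Δ (fun _ : Control G.V t G.T => Control.const t G.T c hc) :=
    fun _ _ _ _ => Eventually.of_forall fun _ _ => rfl
  exact ⟨⟨fun _ => ⟨_, measurable_const, Δ, h⟩, stronglyMeasurable_const, Δ, fun _ => h⟩⟩

theorem nonempty_randomStrategyII (G : Game N E F) (t : ℝ) :
    Nonempty (G.RandomStrategyII Ω₂ t) := by
  obtain ⟨c, hc⟩ := G.V_nonempty
  have h : DelayedAdaptively (fun _ : Control G.U t G.T => Control.const t G.T c hc) :=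
    fun _ _ _ _ => ⟨1, one_pos, fun _ => Eventually.of_forall fun _ _ => rfl⟩
  exact ⟨⟨fun _ => ⟨_, measurable_const, h⟩, stronglyMeasurable_const⟩⟩

theorem abs_payoff_le (G : Game N E F) (P₁ : Measure Ω₁) [IsProbabilityMeasure P₁]
    (P₂ : Measure Ω₂) [IsProbabilityMeasure P₂] {M : ℝ}
    (hM : ∀ x, ∀ t ∈ Icc 0 G.T, ∀ u ∈ G.U, ∀ v ∈ G.V, |G.ℓ x t u v| ≤ M) {t : ℝ}
    (ht : t ∈ Icc 0 G.T) (m : Measure (Space N)) [IsProbabilityMeasure m]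
    (α : G.RandomStrategyI Ω₁ t) (β : G.RandomStrategyII Ω₂ t) :
    |G.payoff P₁ P₂ t α β m| ≤ M * (G.T - t) := by
  have h := norm_integral_le_of_norm_le_const (μ := m.prod (P₁.prod P₂)) (C := M * (G.T - t))
    (f := fun q => G.runningPayoff q.1 (G.outcome (α (q.1, q.2.1)) (β q.2.2)))
    (Eventually.of_forall fun q => G.abs_runningPayoff_le hM ht _ _)
  simpa [payoff] using h

/-! ### Dependence on the law of the parameter -/

section Law

variable [SecondCountableTopology E] [SecondCountableTopology F]
  (G : Game N E F) (P₁ : Measure Ω₁) [IsProbabilityMeasure P₁]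
  (P₂ : Measure Ω₂) [IsProbabilityMeasure P₂]

/-- Player I may draw an auxiliary variable `y` from its conditional law given `x`, and then play
a strategy that depends on `x` and `y`. -/
theorem exists_payoff_eq_integral [StandardBorelSpace Ω₁] [NullSingletonClass P₁] {t : ℝ}
    (ht : t ∈ Icc 0 G.T) {Y : Type*} [MeasurableSpace Y] [StandardBorelSpace Y] [Nonempty Y]
    {A : Space N × Y → G.StrategyI t} (hA : StronglyMeasurable A)
    (hΔ : ∃ Δ : Subdivision t G.T, ∀ p, DelayedAlong Δ (A p).toFun) (m : Measure (Space N))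
    [IsProbabilityMeasure m] (ρ : Measure (Space N × Y)) [IsFiniteMeasure ρ] (hρ : ρ.fst = m) :
    ∃ α : G.RandomStrategyI Ω₁ t, ∀ β : G.RandomStrategyII Ω₂ t,
      G.payoff P₁ P₂ t α β m = ∫ p, G.purePayoff P₂ β p.1 (A p) ∂ρ := by
  obtain ⟨ψ, hψ, hmap⟩ := exists_randomization P₁ m ρ hρ
  have hmeas : Measurable fun p : Space N × Ω₁ => (p.1, ψ p) := measurable_fst.prodMk hψ
  refine ⟨⟨fun p => A (p.1, ψ p), hA.comp_measurable hmeas, hΔ.imp fun Δ h p => h _⟩,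
    fun β => ?_⟩
  rw [G.payoff_eq_integral_purePayoff P₁ P₂ ht, ← hmap, integral_map hmeas.aemeasurable
    (G.measurable_purePayoff P₂ ht.1 β measurable_fst hA hΔ).aestronglyMeasurable]

/-- A strategy against the law `m` is transferred along a coupling to the law `m'`: knowing `x'`,
Player I draws `x` from its conditional law and plays as if the parameter were `x`. -/
theorem exists_payoff_le_add_of_coupling [StandardBorelSpace Ω₁] [NullSingletonClass P₁] {L : ℝ}
    (hL₀ : 0 ≤ L)
    (hL : ∀ x x', ∀ t ∈ Icc 0 G.T, ∀ t' ∈ Icc 0 G.T, ∀ u ∈ G.U, ∀ v ∈ G.V,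
      |G.ℓ x t u v - G.ℓ x' t' u v| ≤ L * (‖x - x'‖ + |t - t'|)) {t : ℝ}
    (ht : t ∈ Icc 0 G.T) {m m' : Measure (Space N)} [IsProbabilityMeasure m]
    [IsProbabilityMeasure m'] {γ : Measure (Space N × Space N)} (hγ : γ ∈ couplings m m')
    (hfin : ∫⁻ p, ‖p.1 - p.2‖ₑ ∂γ ≠ ∞) (α : G.RandomStrategyI Ω₁ t) :
    ∃ α' : G.RandomStrategyI Ω₁ t, ∀ β : G.RandomStrategyII Ω₂ t,
      G.payoff P₁ P₂ t α' β m' ≤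
        G.payoff P₁ P₂ t α β m + L * G.T * (∫⁻ p, ‖p.1 - p.2‖ₑ ∂γ).toReal := by
  have : IsProbabilityMeasure γ := by
    constructor
    rw [← preimage_univ (f := Prod.fst), ← Measure.map_apply measurable_fst .univ, hγ.1]
    exact measure_univ
  have : Nonempty Ω₁ := nonempty_of_isProbabilityMeasure P₁
  have hmeas : Measurable fun q : (Space N × Space N) × Ω₁ => (q.1.2, (q.1.1, q.2)) := by
    fun_prop
  have hmeas' : Measurable fun q : (Space N × Space N) × Ω₁ => (q.1.1, q.2) := by
    fun_prop
  have hρ : (((γ.prod P₁).map fun q : (Space N × Space N) × Ω₁ =>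
      (q.1.2, (q.1.1, q.2)))).fst = m' := by
    rw [Measure.fst, Measure.map_map measurable_fst hmeas]
    have : (Prod.fst ∘ fun q : (Space N × Space N) × Ω₁ => (q.1.2, (q.1.1, q.2)))
        = Prod.snd ∘ Prod.fst := rfl
    rw [this, ← Measure.map_map measurable_snd measurable_fst, Measure.map_fst_prod]
    simpa using hγ.2
  have hm : (γ.prod P₁).map (fun q : (Space N × Space N) × Ω₁ => (q.1.1, q.2)) = m.prod P₁ := by
    have h := Measure.map_prod_map γ P₁ (measurable_fst (α := Space N) (β := Space N))
      (measurable_id (α := Ω₁))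
    rw [hγ.1, Measure.map_id] at h
    exact h.symm
  obtain ⟨Δ, hΔ⟩ := α.delayed
  have hA : StronglyMeasurable fun p : Space N × (Space N × Ω₁) => α p.2 :=
    α.stronglyMeasurable.comp_measurable measurable_snd
  obtain ⟨α', hα'⟩ :=
    G.exists_payoff_eq_integral (Ω₂ := Ω₂) P₁ P₂ ht hA ⟨Δ, fun p => hΔ p.2⟩ m' _ hρ
  refine ⟨α', fun β => ?_⟩
  rw [hα' β, G.payoff_eq_integral_purePayoff P₁ P₂ ht, ← hm,
    integral_map hmeas.aemeasurable (G.measurable_purePayoff P₂ ht.1 β measurable_fst hA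
      ⟨Δ, fun p => hΔ p.2⟩).aestronglyMeasurable,
    integral_map hmeas'.aemeasurable (G.measurable_purePayoff P₂ ht.1 β measurable_fst
      α.stronglyMeasurable ⟨Δ, hΔ⟩).aestronglyMeasurable, ← sub_le_iff_le_add']
  have hα'' : StronglyMeasurable fun q : (Space N × Space N) × Ω₁ => α (q.1.1, q.2) :=
    α.stronglyMeasurable.comp_measurable hmeas'
  have hint₂ : Integrable (fun q : (Space N × Space N) × Ω₁ =>
      G.purePayoff P₂ β q.1.2 (α (q.1.1, q.2))) (γ.prod P₁) :=
    G.integrable_purePayoff P₂ ht β _ (measurable_snd.comp measurable_fst) hα'' ⟨Δ, fun q => hΔ _⟩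
  have hint₁ : Integrable (fun q : (Space N × Space N) × Ω₁ =>
      G.purePayoff P₂ β q.1.1 (α (q.1.1, q.2))) (γ.prod P₁) :=
    G.integrable_purePayoff P₂ ht β _ (measurable_fst.comp measurable_fst) hα'' ⟨Δ, fun q => hΔ _⟩
  have hdist : Integrable (fun p : Space N × Space N => ‖p.1 - p.2‖) γ :=
    ⟨by fun_prop, by simpa [HasFiniteIntegral] using lt_top_iff_ne_top.2 hfin⟩
  have hval : ∫ p, ‖p.1 - p.2‖ ∂γ = (∫⁻ p, ‖p.1 - p.2‖ₑ ∂γ).toReal :=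
    integral_norm_eq_lintegral_enorm (by fun_prop)
  calc _ = ∫ q : (Space N × Space N) × Ω₁, (G.purePayoff P₂ β q.1.2 (α (q.1.1, q.2)) -
          G.purePayoff P₂ β q.1.1 (α (q.1.1, q.2))) ∂(γ.prod P₁) := (integral_sub hint₂ hint₁).symm
    _ ≤ ∫ q : (Space N × Space N) × Ω₁, L * G.T * ‖q.1.1 - q.1.2‖ ∂(γ.prod P₁) := by
        refine integral_mono (hint₂.sub hint₁) ((hdist.comp_fst P₁).const_mul _) fun q => ?_
        refine (le_abs_self _).trans ((G.abs_purePayoff_sub_le P₂ hL ht β _ _ _).trans ?_)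
        rw [norm_sub_rev]
        calc L * ‖q.1.1 - q.1.2‖ * (G.T - t) ≤ L * ‖q.1.1 - q.1.2‖ * G.T := by
              gcongr; linarith [ht.1]
          _ = L * G.T * ‖q.1.1 - q.1.2‖ := by ring
    _ = L * G.T * (∫⁻ p, ‖p.1 - p.2‖ₑ ∂γ).toReal := by
        rw [integral_const_mul, ← hval]
        congr 1
        have := integral_fun_fst (μ := γ) (ν := P₁) (fun p : Space N × Space N => ‖p.1 - p.2‖)
        simpa using this

/-- Player I splits: knowing `x`, he draws one of the two laws `m₁`, `m₂` from its conditional law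
given `x`, and plays the corresponding strategy. -/
theorem exists_payoff_eq_average [StandardBorelSpace Ω₁] [NullSingletonClass P₁] {t : ℝ}
    (ht : t ∈ Icc 0 G.T) (m₁ m₂ : Measure (Space N)) [IsProbabilityMeasure m₁]
    [IsProbabilityMeasure m₂] {p q : ℝ≥0} (hpq : p + q = 1) (α₁ α₂ : G.RandomStrategyI Ω₁ t) :
    ∃ α : G.RandomStrategyI Ω₁ t, ∀ β : G.RandomStrategyII Ω₂ t,
      G.payoff P₁ P₂ t α β (p • m₁ + q • m₂) =
        p * G.payoff P₁ P₂ t α₁ β m₁ + q * G.payoff P₁ P₂ t α₂ β m₂ := by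
  have : Nonempty Ω₁ := nonempty_of_isProbabilityMeasure P₁
  have hprob : IsProbabilityMeasure (p • m₁ + q • m₂) := by
    constructor
    simp only [Measure.coe_add, Measure.coe_nnreal_smul_apply, Pi.add_apply, measure_univ, mul_one]
    exact_mod_cast hpq
  have hmeas : ∀ b : Bool, Measurable fun z : Space N × Ω₁ => (z.1, (b, z.2)) := fun b => by
    fun_prop
  have hfst : ∀ (b : Bool) (m : Measure (Space N)) [IsProbabilityMeasure m],
      (((m.prod P₁).map fun z => (z.1, (b, z.2))).map Prod.fst) = m := by
    intro b m _
    rw [Measure.map_map measurable_fst (hmeas b)]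
    have : (Prod.fst ∘ fun z : Space N × Ω₁ => (z.1, (b, z.2))) = Prod.fst := rfl
    rw [this, Measure.map_fst_prod]
    simp
  obtain ⟨Δ₁, hΔ₁⟩ := α₁.delayed
  obtain ⟨Δ₂, hΔ₂⟩ := α₂.delayed
  obtain ⟨Δ, hΔ⟩ := exists_common_refinement (K := G.U) (L := G.V) Δ₁ Δ₂
  set A : Space N × (Bool × Ω₁) → G.StrategyI t := fun z =>
    if z.2.1 = true then α₁ (z.1, z.2.2) else α₂ (z.1, z.2.2) with hAdef
  have hA : StronglyMeasurable A := by
    refine StronglyMeasurable.ite ?_ (α₁.stronglyMeasurable.comp_measurable (by fun_prop))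
      (α₂.stronglyMeasurable.comp_measurable (by fun_prop))
    exact (measurable_fst.comp measurable_snd) (measurableSet_singleton true)
  have hAΔ : ∃ Δ : Subdivision t G.T, ∀ z, DelayedAlong Δ (A z).toFun := by
    refine ⟨Δ, fun z => ?_⟩
    simp only [hAdef]
    split_ifs
    · exact hΔ _ (Or.inl (hΔ₁ _))
    · exact hΔ _ (Or.inr (hΔ₂ _))
  set ρ₁ := (m₁.prod P₁).map fun z => (z.1, (true, z.2)) with hρ₁
  set ρ₂ := (m₂.prod P₁).map fun z => (z.1, (false, z.2)) with hρ₂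
  obtain ⟨α, hα⟩ := G.exists_payoff_eq_integral (Ω₂ := Ω₂) P₁ P₂ ht hA hAΔ (p • m₁ + q • m₂)
    (p • ρ₁ + q • ρ₂) (by
      rw [Measure.fst, Measure.map_add _ _ measurable_fst, Measure.map_smul, Measure.map_smul,
        hρ₁, hρ₂, hfst, hfst])
  refine ⟨α, fun β => ?_⟩
  have hK := G.measurable_purePayoff P₂ ht.1 β measurable_fst hA hAΔ
  have hint : ∀ ρ : Measure (Space N × (Bool × Ω₁)), IsFiniteMeasure ρ →
      Integrable (fun z => G.purePayoff P₂ β z.1 (A z)) ρ := fun ρ _ =>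
    G.integrable_purePayoff P₂ ht β ρ measurable_fst hA hAΔ
  rw [hα β, integral_add_measure (hint _ inferInstance) (hint _ inferInstance),
    integral_smul_nnreal_measure, integral_smul_nnreal_measure, hρ₁, hρ₂,
    integral_map (hmeas true).aemeasurable hK.aestronglyMeasurable,
    integral_map (hmeas false).aemeasurable hK.aestronglyMeasurable,
    G.payoff_eq_integral_purePayoff P₁ P₂ ht, G.payoff_eq_integral_purePayoff P₁ P₂ ht]
  rfl

end Law

/-! ### Dependence on the initial time -/

section Time

variable {G : Game N E F} {t t' : ℝ}

/-- Start at `t` instead of `t'`, playing the constant action `c` before `t'`. -/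
noncomputable def StrategyI.extend (h : t ≤ t') {c : E} (hc : c ∈ G.U) (α : G.StrategyI t') :
    G.StrategyI t where
  toFun v := (α (v.restrict h)).extend t c hc
  measurable := (Control.lipschitzWith_extend t t' G.T c hc).continuous.measurable.comp
    (α.measurable.comp (Control.lipschitzWith_restrict h).continuous.measurable)
  delayed := by
    obtain ⟨Δ, hΔ⟩ := α.delayed
    obtain ⟨Δ', hΔ'⟩ := exists_delayedAlong_extend (K := G.U) (L := G.V) Δ h hc
    exact ⟨Δ', hΔ' _ hΔ⟩

/-- Start at `t'` instead of `t`, pretending that the opponent played `c` before `t'`. -/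
noncomputable def StrategyI.restrict (h : t ≤ t') (h' : t' ≤ G.T) {c : F} (hc : c ∈ G.V)
    (α : G.StrategyI t) : G.StrategyI t' where
  toFun v := (α (v.extend t c hc)).restrict h
  measurable := (Control.lipschitzWith_restrict h).continuous.measurable.comp
    (α.measurable.comp (Control.lipschitzWith_extend t t' G.T c hc).continuous.measurable)
  delayed := by
    obtain ⟨Δ, hΔ⟩ := α.delayed
    obtain ⟨Δ', hΔ'⟩ := exists_delayedAlong_restrict (K := G.U) (L := G.V) Δ h h' hc
    exact ⟨Δ', hΔ' _ hΔ⟩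

/-- Start at `t` instead of `t'`, playing the constant action `c` before `t'`. -/
noncomputable def StrategyII.extend (h : t ≤ t') {c : F} (hc : c ∈ G.V) (β : G.StrategyII t') :
    G.StrategyII t where
  toFun u := (β (u.restrict h)).extend t c hc
  measurable := (Control.lipschitzWith_extend t t' G.T c hc).continuous.measurable.comp
    (β.measurable.comp (Control.lipschitzWith_restrict h).continuous.measurable)
  delayed := β.delayed.extend h hc

/-- Start at `t'` instead of `t`, pretending that the opponent played `c` before `t'`. -/
noncomputable def StrategyII.restrict (h : t ≤ t') {c : E} (hc : c ∈ G.U) (β : G.StrategyII t) :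
    G.StrategyII t' where
  toFun u := (β (u.extend t c hc)).restrict h
  measurable := (Control.lipschitzWith_restrict h).continuous.measurable.comp
    (β.measurable.comp (Control.lipschitzWith_extend t t' G.T c hc).continuous.measurable)
  delayed := β.delayed.restrict h hc

theorem StrategyI.continuous_extend (h : t ≤ t') {c : E} (hc : c ∈ G.U) :
    Continuous (StrategyI.extend h hc : G.StrategyI t' → G.StrategyI t) :=
  LipschitzWith.continuous (K := 1) <| LipschitzWith.of_edist_le fun α₁ α₂ => by
    rw [G.edist_strategyI, G.edist_strategyI]
    exact iSup_le fun v => ((Control.lipschitzWith_extend t t' G.T c hc).edist_le_mul _ _).trans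
      (by rw [ENNReal.coe_one, one_mul]; exact le_iSup (fun v => edist (α₁ v) (α₂ v)) _)

theorem StrategyI.continuous_restrict (h : t ≤ t') (h' : t' ≤ G.T) {c : F} (hc : c ∈ G.V) :
    Continuous (StrategyI.restrict h h' hc : G.StrategyI t → G.StrategyI t') :=
  LipschitzWith.continuous (K := 1) <| LipschitzWith.of_edist_le fun α₁ α₂ => by
    rw [G.edist_strategyI, G.edist_strategyI]
    exact iSup_le fun v => ((Control.lipschitzWith_restrict h).edist_le_mul _ _).trans
      (by rw [ENNReal.coe_one, one_mul]; exact le_iSup (fun v => edist (α₁ v) (α₂ v)) _)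

theorem StrategyII.continuous_extend (h : t ≤ t') {c : F} (hc : c ∈ G.V) :
    Continuous (StrategyII.extend h hc : G.StrategyII t' → G.StrategyII t) :=
  LipschitzWith.continuous (K := 1) <| LipschitzWith.of_edist_le fun β₁ β₂ => by
    rw [G.edist_strategyII, G.edist_strategyII]
    exact iSup_le fun u => ((Control.lipschitzWith_extend t t' G.T c hc).edist_le_mul _ _).trans
      (by rw [ENNReal.coe_one, one_mul]; exact le_iSup (fun u => edist (β₁ u) (β₂ u)) _)

theorem StrategyII.continuous_restrict (h : t ≤ t') {c : E} (hc : c ∈ G.U) :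
    Continuous (StrategyII.restrict h hc : G.StrategyII t → G.StrategyII t') :=
  LipschitzWith.continuous (K := 1) <| LipschitzWith.of_edist_le fun β₁ β₂ => by
    rw [G.edist_strategyII, G.edist_strategyII]
    exact iSup_le fun u => ((Control.lipschitzWith_restrict h).edist_le_mul _ _).trans
      (by rw [ENNReal.coe_one, one_mul]; exact le_iSup (fun u => edist (β₁ u) (β₂ u)) _)

theorem outcome_extend_left (h : t ≤ t') {c : E} (hc : c ∈ G.U) (α : G.StrategyI t')
    (β : G.StrategyII t) :
    ((G.outcome (α.extend h hc) β).1.restrict h, (G.outcome (α.extend h hc) β).2.restrict h)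
      = G.outcome α (β.restrict h hc) := by
  set p := G.outcome (α.extend h hc) β with hp
  have h1 : (α (p.2.restrict h)).extend t c hc = p.1 :=
    G.strategyI_outcome (α.extend h hc) β
  have h2 : β p.1 = p.2 := G.strategyII_outcome _ _
  have h3 : p.1.restrict h = α (p.2.restrict h) := by rw [← h1, Control.restrict_extend]
  refine (G.outcome_eq_iff _ _ _ _).2 ⟨h3.symm, ?_⟩
  change (β ((p.1.restrict h).extend t c hc)).restrict h = _
  rw [h3, h1, h2]

theorem outcome_extend_right (h : t ≤ t') (h' : t' ≤ G.T) {c : F} (hc : c ∈ G.V)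
    (α : G.StrategyI t) (β : G.StrategyII t') :
    ((G.outcome α (β.extend h hc)).1.restrict h, (G.outcome α (β.extend h hc)).2.restrict h)
      = G.outcome (α.restrict h h' hc) β := by
  set p := G.outcome α (β.extend h hc) with hp
  have h1 : α p.2 = p.1 := G.strategyI_outcome _ _
  have h2 : (β (p.1.restrict h)).extend t c hc = p.2 :=
    G.strategyII_outcome α (β.extend h hc)
  have h3 : p.2.restrict h = β (p.1.restrict h) := by rw [← h2, Control.restrict_extend]
  refine (G.outcome_eq_iff _ _ _ _).2 ⟨?_, h3.symm⟩
  change (α ((p.2.restrict h).extend t c hc)).restrict h = _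
  rw [h3, h2, h1]

/-- The pointwise extension of a random strategy of Player I. -/
noncomputable def RandomStrategyI.extend (h : t ≤ t') {c : E} (hc : c ∈ G.U)
    (α : G.RandomStrategyI Ω₁ t') : G.RandomStrategyI Ω₁ t where
  toFun p := (α p).extend h hc
  stronglyMeasurable :=
    (StrategyI.continuous_extend h hc).comp_stronglyMeasurable α.stronglyMeasurable
  delayed := by
    obtain ⟨Δ, hΔ⟩ := α.delayed
    obtain ⟨Δ', hΔ'⟩ := exists_delayedAlong_extend (K := G.U) (L := G.V) Δ h hc
    exact ⟨Δ', fun p => hΔ' _ (hΔ p)⟩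

/-- The pointwise restriction of a random strategy of Player I. -/
noncomputable def RandomStrategyI.restrict (h : t ≤ t') (h' : t' ≤ G.T) {c : F} (hc : c ∈ G.V)
    (α : G.RandomStrategyI Ω₁ t) : G.RandomStrategyI Ω₁ t' where
  toFun p := (α p).restrict h h' hc
  stronglyMeasurable :=
    (StrategyI.continuous_restrict h h' hc).comp_stronglyMeasurable α.stronglyMeasurable
  delayed := by
    obtain ⟨Δ, hΔ⟩ := α.delayed
    obtain ⟨Δ', hΔ'⟩ := exists_delayedAlong_restrict (K := G.U) (L := G.V) Δ h h' hc
    exact ⟨Δ', fun p => hΔ' _ (hΔ p)⟩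

/-- The pointwise extension of a random strategy of Player II. -/
noncomputable def RandomStrategyII.extend (h : t ≤ t') {c : F} (hc : c ∈ G.V)
    (β : G.RandomStrategyII Ω₂ t') : G.RandomStrategyII Ω₂ t where
  toFun ω := (β ω).extend h hc
  stronglyMeasurable :=
    (StrategyII.continuous_extend h hc).comp_stronglyMeasurable β.stronglyMeasurable

/-- The pointwise restriction of a random strategy of Player II. -/
noncomputable def RandomStrategyII.restrict (h : t ≤ t') {c : E} (hc : c ∈ G.U)
    (β : G.RandomStrategyII Ω₂ t) : G.RandomStrategyII Ω₂ t' where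
  toFun ω := (β ω).restrict h hc
  stronglyMeasurable :=
    (StrategyII.continuous_restrict h hc).comp_stronglyMeasurable β.stronglyMeasurable

variable [SecondCountableTopology E] [SecondCountableTopology F]

/-- If the outcomes of the game from `t'` are the restrictions of the outcomes of the game from
`t`, then the payoffs differ by what is collected between `t` and `t'`. -/
theorem abs_payoff_sub_le_of_outcome (P₁ : Measure Ω₁) [IsProbabilityMeasure P₁]
    (P₂ : Measure Ω₂) [IsProbabilityMeasure P₂] {M : ℝ}
    (hM : ∀ x, ∀ t ∈ Icc 0 G.T, ∀ u ∈ G.U, ∀ v ∈ G.V, |G.ℓ x t u v| ≤ M)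
    (ht : 0 ≤ t) (h : t ≤ t') (h' : t' ≤ G.T) (m : Measure (Space N)) [IsProbabilityMeasure m]
    (α : G.RandomStrategyI Ω₁ t) (β : G.RandomStrategyII Ω₂ t)
    (α' : G.RandomStrategyI Ω₁ t') (β' : G.RandomStrategyII Ω₂ t')
    (hout : ∀ p ω, ((G.outcome (α p) (β ω)).1.restrict h, (G.outcome (α p) (β ω)).2.restrict h)
      = G.outcome (α' p) (β' ω)) :
    |G.payoff P₁ P₂ t α β m - G.payoff P₁ P₂ t' α' β' m| ≤ M * (t' - t) := by
  have hint : ∀ {s : ℝ} (_ : s ∈ Icc 0 G.T) (α : G.RandomStrategyI Ω₁ s)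
      (β : G.RandomStrategyII Ω₂ s), Integrable (fun q : Space N × Ω₁ × Ω₂ =>
        G.runningPayoff q.1 (G.outcome (α (q.1, q.2.1)) (β q.2.2))) (m.prod (P₁.prod P₂)) := by
    intro s hs α β
    obtain ⟨Δ, hΔ⟩ := α.delayed
    exact G.integrable_runningPayoff_outcome hs _ measurable_fst
      (α.stronglyMeasurable.comp_measurable (by fun_prop)) ⟨Δ, fun q => hΔ _⟩
      (β.stronglyMeasurable.comp_measurable (by fun_prop))
  rw [payoff, payoff, ← integral_sub (hint ⟨ht, h.trans h'⟩ α β) (hint ⟨ht.trans h, h'⟩ α' β')]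
  have hle := norm_integral_le_of_norm_le_const (μ := m.prod (P₁.prod P₂)) (C := M * (t' - t))
    (f := fun q => G.runningPayoff q.1 (G.outcome (α (q.1, q.2.1)) (β q.2.2)) -
      G.runningPayoff q.1 (G.outcome (α' (q.1, q.2.1)) (β' q.2.2)))
    (Eventually.of_forall fun q => by
      rw [← hout]
      exact G.abs_runningPayoff_restrict_sub_le hM ht h h' _ _)
  simpa using hle

end Time

/-! ### Regularity of the values -/

section Values

variable [SecondCountableTopology E] [SecondCountableTopology F]
  (G : Game N E F) (P₁ : Measure Ω₁) [IsProbabilityMeasure P₁]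
  (P₂ : Measure Ω₂) [IsProbabilityMeasure P₂]

theorem abs_values_sub_le_of_le {M : ℝ}
    (hM : ∀ x, ∀ t ∈ Icc 0 G.T, ∀ u ∈ G.U, ∀ v ∈ G.V, |G.ℓ x t u v| ≤ M) {t t' : ℝ}
    (ht : 0 ≤ t) (h : t ≤ t') (h' : t' ≤ G.T) (m : Measure (Space N)) [IsProbabilityMeasure m] :
    |G.upperValue P₁ P₂ t m - G.upperValue P₁ P₂ t' m| ≤ M * (t' - t) ∧
      |G.lowerValue P₁ P₂ t m - G.lowerValue P₁ P₂ t' m| ≤ M * (t' - t) := by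
  obtain ⟨c, hc⟩ := G.U_nonempty
  obtain ⟨d, hd⟩ := G.V_nonempty
  have := G.nonempty_randomStrategyI (Ω₁ := Ω₁) (h.trans h')
  have := G.nonempty_randomStrategyI (Ω₁ := Ω₁) h'
  have := G.nonempty_randomStrategyII (Ω₂ := Ω₂) t
  have := G.nonempty_randomStrategyII (Ω₂ := Ω₂) t'
  have hb := G.abs_payoff_le P₁ P₂ hM ⟨ht, h.trans h'⟩ m
  have hb' := G.abs_payoff_le P₁ P₂ hM ⟨ht.trans h, h'⟩ m
  have h1 := minmax_le_add hb hb' (ε := M * (t' - t)) (RandomStrategyI.extend h hc)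
    (RandomStrategyII.restrict h hc) fun α β => by
      have := (abs_le.1 (abs_payoff_sub_le_of_outcome P₁ P₂ hM ht h h' m (α.extend h hc) β α
        (β.restrict h hc) fun p ω => outcome_extend_left h hc (α p) (β ω))).2
      linarith
  have h2 := minmax_le_add hb' hb (ε := M * (t' - t)) (RandomStrategyI.restrict h h' hd)
    (RandomStrategyII.extend h hd) fun α β => by
      have := (abs_le.1 (abs_payoff_sub_le_of_outcome P₁ P₂ hM ht h h' m α (β.extend h hd)
        (α.restrict h h' hd) β fun p ω => outcome_extend_right h h' hd (α p) (β ω))).1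
      linarith
  unfold upperValue lowerValue
  exact ⟨abs_le.2 ⟨by linarith [h2.1], by linarith [h1.1]⟩,
    abs_le.2 ⟨by linarith [h2.2], by linarith [h1.2]⟩⟩

theorem abs_values_sub_le {M : ℝ}
    (hM : ∀ x, ∀ t ∈ Icc 0 G.T, ∀ u ∈ G.U, ∀ v ∈ G.V, |G.ℓ x t u v| ≤ M) {t t' : ℝ}
    (ht : t ∈ Icc 0 G.T) (ht' : t' ∈ Icc 0 G.T) (m : Measure (Space N)) [IsProbabilityMeasure m] :
    |G.upperValue P₁ P₂ t m - G.upperValue P₁ P₂ t' m| ≤ M * |t - t'| ∧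
      |G.lowerValue P₁ P₂ t m - G.lowerValue P₁ P₂ t' m| ≤ M * |t - t'| := by
  rcases le_total t t' with h | h
  · rw [abs_sub_comm t t', abs_of_nonneg (sub_nonneg.2 h)]
    exact G.abs_values_sub_le_of_le P₁ P₂ hM ht.1 h ht'.2 m
  · rw [abs_of_nonneg (sub_nonneg.2 h), abs_sub_comm (G.upperValue P₁ P₂ t m),
      abs_sub_comm (G.lowerValue P₁ P₂ t m)]
    exact G.abs_values_sub_le_of_le P₁ P₂ hM ht'.1 h ht.2 m

theorem values_le_add_d1 [StandardBorelSpace Ω₁] [NullSingletonClass P₁] {L : ℝ} (hL₀ : 0 ≤ L)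
    (hL : ∀ x x', ∀ t ∈ Icc 0 G.T, ∀ t' ∈ Icc 0 G.T, ∀ u ∈ G.U, ∀ v ∈ G.V,
      |G.ℓ x t u v - G.ℓ x' t' u v| ≤ L * (‖x - x'‖ + |t - t'|)) {t : ℝ}
    (ht : t ∈ Icc 0 G.T) {m m' : Measure (Space N)} [IsProbabilityMeasure m]
    [IsProbabilityMeasure m'] (hfin : d1 m m' ≠ ∞) :
    G.upperValue P₁ P₂ t m' ≤ G.upperValue P₁ P₂ t m + L * G.T * (d1 m m').toReal ∧
      G.lowerValue P₁ P₂ t m' ≤ G.lowerValue P₁ P₂ t m + L * G.T * (d1 m m').toReal := by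
  have := G.nonempty_randomStrategyI (Ω₁ := Ω₁) ht.2
  have := G.nonempty_randomStrategyII (Ω₂ := Ω₂) t
  obtain ⟨M, hM⟩ := G.ℓ_bounded
  have hLT : 0 ≤ L * G.T := mul_nonneg hL₀ G.T_pos.le
  have key : ∀ ε > 0,
      G.upperValue P₁ P₂ t m' ≤ G.upperValue P₁ P₂ t m + L * G.T * ((d1 m m').toReal + ε) ∧
      G.lowerValue P₁ P₂ t m' ≤ G.lowerValue P₁ P₂ t m + L * G.T * ((d1 m m').toReal + ε) := by
    intro ε hε
    have hlt : d1 m m' < d1 m m' + ENNReal.ofReal ε :=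
      ENNReal.lt_add_right hfin (by simpa using hε)
    obtain ⟨γ, hγ⟩ := iInf_lt_iff.1 hlt
    obtain ⟨hγ, hcost⟩ := iInf_lt_iff.1 hγ
    have htop : d1 m m' + ENNReal.ofReal ε ≠ ∞ := ENNReal.add_ne_top.2 ⟨hfin, ENNReal.ofReal_ne_top⟩
    have hle : (∫⁻ p, ‖p.1 - p.2‖ₑ ∂γ).toReal ≤ (d1 m m').toReal + ε := by
      have := ENNReal.toReal_mono htop hcost.le
      rwa [ENNReal.toReal_add hfin ENNReal.ofReal_ne_top, ENNReal.toReal_ofReal hε.le] at this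
    choose φ hφ using G.exists_payoff_le_add_of_coupling (Ω₂ := Ω₂) P₁ P₂ hL₀ hL ht hγ
      hcost.ne_top
    exact minmax_le_add (G.abs_payoff_le P₁ P₂ hM ht m') (G.abs_payoff_le P₁ P₂ hM ht m) φ id
      fun α β => (hφ α β).trans (by simp only [id]; gcongr)
  have hlim : Tendsto (fun ε : ℝ => L * G.T * ((d1 m m').toReal + ε)) (𝓝[>] 0)
      (𝓝 (L * G.T * (d1 m m').toReal)) := by
    have : Continuous fun ε : ℝ => L * G.T * ((d1 m m').toReal + ε) := by fun_prop
    simpa using (this.tendsto 0).mono_left nhdsWithin_le_nhds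
  exact ⟨ge_of_tendsto (tendsto_const_nhds.add hlim)
      (eventually_nhdsWithin_of_forall fun ε hε => (key ε hε).1),
    ge_of_tendsto (tendsto_const_nhds.add hlim)
      (eventually_nhdsWithin_of_forall fun ε hε => (key ε hε).2)⟩

end Values

end Game

theorem d1_comm_le {N : ℕ} (m m' : Measure (Space N)) : d1 m m' ≤ d1 m' m := by
  refine le_iInf₂ fun γ hγ => ?_
  have hswap : γ.map Prod.swap ∈ couplings m m' := by
    constructor
    · rw [Measure.map_map measurable_fst measurable_swap]; exact hγ.2
    · rw [Measure.map_map measurable_snd measurable_swap]; exact hγ.1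
  refine (iInf₂_le _ hswap).trans ?_
  rw [lintegral_map (by fun_prop) measurable_swap]
  refine (lintegral_congr fun p => ?_).le
  rw [Prod.fst_swap, Prod.snd_swap, ← neg_sub, enorm_neg]

theorem d1_comm {N : ℕ} (m m' : Measure (Space N)) : d1 m m' = d1 m' m :=
  le_antisymm (d1_comm_le m m') (d1_comm_le m' m)

theorem convex_Pi2 (N : ℕ) : Convex ℝ≥0 (Pi2 N) := by
  rintro m₁ ⟨h₁, hm₁⟩ m₂ ⟨h₂, hm₂⟩ p q - - hpq
  refine ⟨⟨?_⟩, ?_⟩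
  · simp only [Measure.coe_add, Measure.coe_nnreal_smul_apply, Pi.add_apply, measure_univ, mul_one]
    exact_mod_cast hpq
  · rw [lintegral_add_measure, lintegral_smul_measure, lintegral_smul_measure]
    exact ENNReal.add_lt_top.2 ⟨ENNReal.mul_lt_top ENNReal.coe_lt_top hm₁,
      ENNReal.mul_lt_top ENNReal.coe_lt_top hm₂⟩

theorem Game.convexOn_values {N : ℕ} {E F : Type*} [NormedAddCommGroup E] [NormedAddCommGroup F]
    [SecondCountableTopology E] [SecondCountableTopology F] (G : Game N E F)
    {Ω₁ Ω₂ : Type*} [MeasurableSpace Ω₁] [StandardBorelSpace Ω₁] [MeasurableSpace Ω₂]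
    (P₁ : Measure Ω₁) [IsProbabilityMeasure P₁] [NullSingletonClass P₁]
    (P₂ : Measure Ω₂) [IsProbabilityMeasure P₂] {t : ℝ} (ht : t ∈ Icc 0 G.T) :
    ConvexOn ℝ≥0 (Pi2 N) (fun m => G.upperValue P₁ P₂ t m) ∧
      ConvexOn ℝ≥0 (Pi2 N) (fun m => G.lowerValue P₁ P₂ t m) := by
  have := G.nonempty_randomStrategyI (Ω₁ := Ω₁) ht.2
  have := G.nonempty_randomStrategyII (Ω₂ := Ω₂) t
  obtain ⟨M, hM⟩ := G.ℓ_bounded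
  have key : ∀ m₁ ∈ Pi2 N, ∀ m₂ ∈ Pi2 N, ∀ p q : ℝ≥0, p + q = 1 →
      G.upperValue P₁ P₂ t (p • m₁ + q • m₂)
        ≤ p * G.upperValue P₁ P₂ t m₁ + q * G.upperValue P₁ P₂ t m₂ ∧
      G.lowerValue P₁ P₂ t (p • m₁ + q • m₂)
        ≤ p * G.lowerValue P₁ P₂ t m₁ + q * G.lowerValue P₁ P₂ t m₂ := by
    intro m₁ h₁ m₂ h₂ p q hpq
    have := (convex_Pi2 N h₁ h₂ (zero_le (a := p)) (zero_le (a := q)) hpq).1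
    have := h₁.1
    have := h₂.1
    choose φ hφ using G.exists_payoff_eq_average (Ω₂ := Ω₂) P₁ P₂ ht m₁ m₂ hpq
    exact minmax_le_average (G.abs_payoff_le P₁ P₂ hM ht _) (G.abs_payoff_le P₁ P₂ hM ht m₁)
      (G.abs_payoff_le P₁ P₂ hM ht m₂) p.2 q.2 φ hφ
  exact ⟨⟨convex_Pi2 N, fun m₁ h₁ m₂ h₂ p q _ _ hpq => (key m₁ h₁ m₂ h₂ p q hpq).1⟩,
    ⟨convex_Pi2 N, fun m₁ h₁ m₂ h₂ p q _ _ hpq => (key m₁ h₁ m₂ h₂ p q hpq).2⟩⟩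

end IncompleteInfoGame

/-- For a game with incomplete information on one side, and with standard Borel atomless
probability spaces on which the players randomize, the upper and lower values are Lipschitz in
`(t, m)` on `[0,T] × Π₂`, with respect to `|t - t'| + d₁(m, m')`, and convex in `m` on `Π₂`. -/
theorem lemma2p2 {N : ℕ} {E F : Type*}
    [NormedAddCommGroup E] [NormedSpace ℝ E] [FiniteDimensional ℝ E]
    [NormedAddCommGroup F] [NormedSpace ℝ F] [FiniteDimensional ℝ F]
    (G : IncompleteInfoGame.Game N E F)
    {Ω₁ Ω₂ : Type*} [MeasurableSpace Ω₁] [StandardBorelSpace Ω₁]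
    [MeasurableSpace Ω₂] [StandardBorelSpace Ω₂]
    (P₁ : Measure Ω₁) [IsProbabilityMeasure P₁] [NullSingletonClass P₁]
    (P₂ : Measure Ω₂) [IsProbabilityMeasure P₂] [NullSingletonClass P₂] :
    (∃ C : ℝ≥0, ∀ t ∈ Icc 0 G.T, ∀ t' ∈ Icc 0 G.T,
      ∀ m ∈ IncompleteInfoGame.Pi2 N, ∀ m' ∈ IncompleteInfoGame.Pi2 N,
        |G.upperValue P₁ P₂ t m - G.upperValue P₁ P₂ t' m'|
            ≤ C * (|t - t'| + (IncompleteInfoGame.d1 m m').toReal) ∧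
        |G.lowerValue P₁ P₂ t m - G.lowerValue P₁ P₂ t' m'|
            ≤ C * (|t - t'| + (IncompleteInfoGame.d1 m m').toReal)) ∧
    (∀ t ∈ Icc 0 G.T,
      ConvexOn ℝ≥0 (IncompleteInfoGame.Pi2 N) (fun m => G.upperValue P₁ P₂ t m) ∧
      ConvexOn ℝ≥0 (IncompleteInfoGame.Pi2 N) (fun m => G.lowerValue P₁ P₂ t m)) := by
  refine ⟨?_, fun t ht => G.convexOn_values P₁ P₂ ht⟩
  obtain ⟨M, hM⟩ := G.ℓ_bounded
  obtain ⟨L₀, hL₀⟩ := G.ℓ_lipschitz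
  have hL : ∀ x x', ∀ t ∈ Icc 0 G.T, ∀ t' ∈ Icc 0 G.T, ∀ u ∈ G.U, ∀ v ∈ G.V,
      |G.ℓ x t u v - G.ℓ x' t' u v| ≤ |L₀| * (‖x - x'‖ + |t - t'|) :=
    fun x x' t ht t' ht' u hu v hv => (hL₀ x x' t ht t' ht' u hu v hv).trans
      (by gcongr; exact le_abs_self L₀)
  have hT := G.T_pos.le
  refine ⟨(|M| + |L₀| * G.T).toNNReal, fun t ht t' ht' m hm m' hm' => ?_⟩
  have := hm.1
  have := hm'.1
  have hfin := IncompleteInfoGame.d1_ne_top hm hm'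
  have h1 := G.values_le_add_d1 P₁ P₂ (abs_nonneg L₀) hL ht' hfin
  have h2 := G.values_le_add_d1 P₁ P₂ (abs_nonneg L₀) hL ht'
    (IncompleteInfoGame.d1_comm m m' ▸ hfin)
  rw [← IncompleteInfoGame.d1_comm m m'] at h2
  have h3 := G.abs_values_sub_le P₁ P₂ hM ht ht' m
  set d := (IncompleteInfoGame.d1 m m').toReal
  have hd : 0 ≤ d := ENNReal.toReal_nonneg
  have hMt : M * |t - t'| ≤ |M| * |t - t'| := by gcongr; exact le_abs_self M
  have hcross : 0 ≤ |M| * d + |L₀| * G.T * |t - t'| := by positivity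
  rw [Real.coe_toNNReal _ (by positivity)]
  obtain ⟨h3u, h3l⟩ := h3
  rw [abs_le] at h3u h3l
  constructor <;> rw [abs_le] <;> constructor <;> linarith [h1.1, h1.2, h2.1, h2.2]
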